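/- **Notation.** Let $S^1=\mathbb R/\mathbb Z$ with its counterclockwise orientation; $(a,b)$ and $(a,b]$ denote the open, resp. left-open right-closed, arcs from $a$ counterclockwise to $b$. Let $f:S^1\to S^1$ be an orientation preserving homeomorphism all of whose orbits are dense (a *minimal* circle homeomorphism), let $\rho=\rho(f)\in[0,1)$ be its rotation number, assumed irrational, and let $\mu_f$ be its unique invariant Borel probability measure. Let $G(t)=\{1/t\}$ (with $G(0)=0$) be the Gauss map, $a_n=\lfloor 1/G^n(\rho)\rfloor$, so that $\rho=[a_0,a_1,\dots]$, and $q_0=1$, $q_1=a_0$, $q_{n+1}=a_nq_n+q_{n-1}$ for $n\ge 1$. Fix $x\in S^1$. For $n\ge 0$ let $I_n$ be that one of the two arcs $(x,f^{q_n}(x)]$, $(f^{q_n}(x),x]$ which contains $f^{q_{n+2}}(x)$. For each $n\ge0$ the *long* intervals $f^i(I_n)$, $0\le i<q_{n+1}$, and the *short* intervals $f^j(I_{n+1})$, $0\le j<q_n$, form a partition of $S^1$. For $z\in I_m$ let $\langle x,z\rangle_m$ be the open arc with endpoints $x$ and $z$ contained in $I_m$ (empty if $z=x$). The *renormalization trail*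 of $y\in S^1$ with respect to $x$ and $f$ is the sequence $\{(\rho_n,\alpha_n)\}_{n\ge0}$ in $[0,1]\times[-1,1]$ defined as follows. First, $\rho_n=G^n(\rho)$ for all $n\ge0$. Next, $\alpha_0=\mu_f(\langle x,y\rangle_1)$ if $y\in I_1$, and $\alpha_0=1-\mu_f((x,y))$ otherwise. Finally, for $n\ge 0$: if $y$ belongs to a long interval $f^i(I_n)$ with $0\le i<q_{n+1}$, let $y_n\in I_n$ be such that $f^i(y_n)=y$ and put $\alpha_{n+1}=\mu_f(\langle x,y_n\rangle_n)/\mu_f(I_n)$; otherwise $y$ belongs to a short interval $f^j(I_{n+1})$ with $0\le j<q_n$, and, with $y_n\in I_{n+1}$ such that $f^j(y_n)=y$, put $\alpha_{n+1}=-\mu_f(\langle x,y_n\rangle_{n+1})/\mu_f(I_{n+1})$. **Theorem.** There exists a set $\mathbf R\subset[0,1]$ of irrational numbers, of full Lebesgue measure in $[0,1]$, with the following property: for every minimal orientation preserving circle homeomorphism $f$ with $\rho(f)\in\mathbf R$ (which then has a unique invariant Borel probability measure $\mu_f$) and every $x\in S^1$ there exists a set $\mathcal B_x\subset S^1$, residual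 in the sense of Baire and of full $\mu_f$-measure, such that for all $y\in\mathcal B_x$ the renormalization trail $\{(\rho_n,\alpha_n)\}_{n\ge0}$ of $y$ with respect to $x$ and $f$ is dense in the rectangle $[0,1]\times[-1,1]$. -/

import Mathlib

open Set MeasureTheory

noncomputable section

namespace CircleTrail

/-- The unit circle `S¹ = ℝ / ℤ`, with its counterclockwise cyclic order. -/
abbrev S1 : Type := UnitAddCircle

/-! ### Circle homeomorphisms -/

/-- `F : ℝ → ℝ`, continuous, non-decreasing and commuting with `t ↦ t + 1`, lifts `f`. -/
def IsLift (F : CircleDeg1Lift) (f : S1 ≃ₜ S1) : Prop :=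
  Continuous F ∧ ∀ t : ℝ, ((F t : ℝ) : S1) = f (t : S1)

/-- A circle homeomorphism preserves orientation if it has a non-decreasing lift of degree one. -/
def OrientationPreserving (f : S1 ≃ₜ S1) : Prop :=
  ∃ F : CircleDeg1Lift, IsLift F f

/-- A homeomorphism is minimal if all its orbits `{fⁿ(x) : n ∈ ℤ}` are dense. -/
def MinimalHomeo (f : S1 ≃ₜ S1) : Prop :=
  ∀ x : S1, Dense (Set.range fun n : ℤ => (f ^ n) x)

open Classical in
/-- The rotation number of an orientation preserving circle homeomorphism, as an element of
`[0, 1)`: the translation number of any lift, modulo one (see `rotationNumber_eq`). -/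
def rotationNumber (f : S1 ≃ₜ S1) : ℝ :=
  if h : OrientationPreserving f then Int.fract (CircleDeg1Lift.translationNumber h.choose) else 0

/-- Two lifts of the same homeomorphism have the same translation number modulo one. -/
theorem fract_translationNumber_eq {f : S1 ≃ₜ S1} {F G : CircleDeg1Lift}
    (hF : IsLift F f) (hG : IsLift G f) :
    Int.fract (CircleDeg1Lift.translationNumber F) =
      Int.fract (CircleDeg1Lift.translationNumber G) := by
  have hint : ∀ t : ℝ, ∃ m : ℤ, F t - G t = m := by
    intro t
    have h : ((F t - G t : ℝ) : S1) = 0 := by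
      rw [AddCircle.coe_sub, hF.2, hG.2, sub_self]
    obtain ⟨m, hm⟩ := (AddCircle.coe_eq_zero_iff (1 : ℝ)).1 h
    exact ⟨m, by rw [← hm]; simp⟩
  choose m hm using hint
  have hcont : Continuous m := by
    rw [Int.isClosedEmbedding_coe_real.isInducing.continuous_iff]
    have : (Int.cast ∘ m : ℝ → ℝ) = fun t => F t - G t := by
      funext t; exact (hm t).symm
    rw [this]
    exact hF.1.sub hG.1
  have hconst : ∀ t, m t = m 0 := fun t => PreconnectedSpace.constant inferInstance hcont
  have hFG : F =
      (CircleDeg1Lift.translate (Multiplicative.ofAdd ((m 0 : ℤ) : ℝ)) : CircleDeg1Lift) * G := by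
    ext t
    rw [CircleDeg1Lift.mul_apply, CircleDeg1Lift.translate_apply, ← hconst t, ← hm t]
    ring
  have hcomm : Commute
      (CircleDeg1Lift.translate (Multiplicative.ofAdd ((m 0 : ℤ) : ℝ)) : CircleDeg1Lift) G := by
    ext t
    simp only [CircleDeg1Lift.mul_apply, CircleDeg1Lift.translate_apply]
    rw [CircleDeg1Lift.map_int_add]
  rw [hFG, CircleDeg1Lift.translationNumber_mul_of_commute hcomm,
    CircleDeg1Lift.translationNumber_translate, Int.fract_intCast_add]

theorem rotationNumber_eq {f : S1 ≃ₜ S1} {F : CircleDeg1Lift} (hF : IsLift F f) :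
    rotationNumber f = Int.fract (CircleDeg1Lift.translationNumber F) := by
  have h : OrientationPreserving f := ⟨F, hF⟩
  rw [rotationNumber, dif_pos h]
  exact fract_translationNumber_eq h.choose_spec hF

/-- `μ` is an `f`-invariant Borel probability measure. -/
def IsInvariantProbability (f : S1 ≃ₜ S1) (μ : Measure S1) : Prop :=
  IsProbabilityMeasure μ ∧ μ.map f = μ

/-! ### Continued fractions -/

/-- The Gauss map `G(ρ) = {1/ρ}`, with `G(0) = 0`. -/
def gauss (ρ : ℝ) : ℝ := Int.fract (1 / ρ)

/-- The partial quotients `aₙ = ⌊1 / Gⁿ(ρ)⌋` of `ρ = [a₀, a₁, …] ∈ (0, 1)`. -/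
def partialQuotient (ρ : ℝ) (n : ℕ) : ℕ := ⌊1 / gauss^[n] ρ⌋₊

/-- The return times: `q₀ = 1`, `q₁ = a₀`, `qₙ₊₂ = aₙ₊₁ qₙ₊₁ + qₙ`. -/
def returnTime (ρ : ℝ) : ℕ → ℕ
  | 0 => 1
  | 1 => partialQuotient ρ 0
  | n + 2 => partialQuotient ρ (n + 1) * returnTime ρ (n + 1) + returnTime ρ n

/-! ### Dynamical intervals -/

/-- The arc `(a, b]` from `a` to `b` in the counterclockwise sense, for `a ≠ b`. -/
def arcIoc (a b : S1) : Set S1 := insert b (Set.cIoo a b)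

open Classical in
/-- `Iₙ`: of the two arcs with endpoints `x` and `f^{qₙ}(x)`, open on the left and closed on the
right, the one that contains `f^{qₙ₊₂}(x)`. -/
def dynInterval (f : S1 ≃ₜ S1) (x : S1) (n : ℕ) : Set S1 :=
  let q := returnTime (rotationNumber f)
  if f^[q (n + 2)] x ∈ arcIoc x (f^[q n] x) then arcIoc x (f^[q n] x) else arcIoc (f^[q n] x) x

open Classical in
/-- The open arc with endpoints `x` and `z` that lies in the interval `I`
(where `x` is an endpoint of `I` and `z ∈ I`). -/
def openArcIn (I : Set S1) (x z : S1) : Set S1 :=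
  if Set.cIoo x z ⊆ I then Set.cIoo x z else Set.cIoo z x

/-! ### Renormalization trails -/

/-- `y` lies in the long interval `fⁱ(Iₙ)`, `0 ≤ i < qₙ₊₁`, and `z ∈ Iₙ` satisfies `fⁱ(z) = y`. -/
def IsLongAncestor (f : S1 ≃ₜ S1) (x y : S1) (n : ℕ) (z : S1) : Prop :=
  z ∈ dynInterval f x n ∧ ∃ i < returnTime (rotationNumber f) (n + 1), f^[i] z = y

/-- `y` lies in the short interval `fʲ(Iₙ₊₁)`, `0 ≤ j < qₙ`, and `z ∈ Iₙ₊₁` satisfies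
`fʲ(z) = y`. -/
def IsShortAncestor (f : S1 ≃ₜ S1) (x y : S1) (n : ℕ) (z : S1) : Prop :=
  z ∈ dynInterval f x (n + 1) ∧ ∃ j < returnTime (rotationNumber f) n, f^[j] z = y

open Classical in
/-- The renormalization ancestor `yₙ` of `y`.  The long intervals `fⁱ(Iₙ)` and the short intervals
`fʲ(Iₙ₊₁)` partition the circle, so exactly one of the first two cases occurs and the point `yₙ`
is unique; the last value is never taken. -/
def ancestor (f : S1 ≃ₜ S1) (x y : S1) (n : ℕ) : S1 :=
  if h : ∃ z, IsLongAncestor f x y n z then h.choose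
  else if h : ∃ z, IsShortAncestor f x y n z then h.choose
  else y

open Classical in
/-- The second coordinates `αₙ` of the trail of `y` with respect to `x` and `f`, where `μ` is the
`f`-invariant probability measure. -/
def trailAlpha (f : S1 ≃ₜ S1) (μ : Measure S1) (x y : S1) : ℕ → ℝ
  | 0 =>
    if y ∈ dynInterval f x 1 then μ.real (openArcIn (dynInterval f x 1) x y)
    else 1 - μ.real (Set.cIoo x y)
  | n + 1 =>
    if ∃ z, IsLongAncestor f x y n z then
      μ.real (openArcIn (dynInterval f x n) x (ancestor f x y n)) / μ.real (dynInterval f x n)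
    else
      -(μ.real (openArcIn (dynInterval f x (n + 1)) x (ancestor f x y n)) /
        μ.real (dynInterval f x (n + 1)))

/-- The renormalization trail `(ρₙ, αₙ)` of `y` with respect to `x` and `f`. -/
def trail (f : S1 ≃ₜ S1) (μ : Measure S1) (x y : S1) (n : ℕ) : ℝ × ℝ :=
  (gauss^[n] (rotationNumber f), trailAlpha f μ x y n)

end CircleTrail

end

open Filter Topology

namespace CircleTrail

/-! A minimal homeomorphism with irrational rotation number ρ is conjugate to the rotation by ρ,
preserving cyclic order (`exists_conj_rotation`), and its unique invariant measure is the pullback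
of Lebesgue measure. With x placed at 0, Iₙ is the arc from 0 to sₙ = qₙρ − pₙ = (−1)ⁿδₙ. Apart from
endpoints, αₙ₊₁ = θ when y sits at iρ + θsₙ in the long tower, and αₙ₊₁ = −θ when y sits at jρ +
θsₙ₊₁ in the short one.

Density of the trail thus means: for all rational c < d and e < g in (0, 1), and for each of the two
kinds of tower, some n has Gⁿ⁺¹(ρ) in (c, d) and y in the part e < θ < g of the tower. For fixed c,
d, e, g such y form an open set. If it has full measure it is also dense, and a countable
intersection of these sets is both residual and of full measure.

Full measure rests on two facts. The set `gaussGeneric` of ρ with dense Gauss orbit has full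
measure, by Lebesgue density and bounded distortion of the inverse branches
(`ae_exists_gauss_iterate_mem`), so the right n occur infinitely often. The corresponding subtowers
have measure bounded below, so their limsup set has positive measure. The rotation moves each storey
to the next, and the top storeys have summable measure; by Borel–Cantelli the limsup set is
invariant up to a null set, hence of full measure by ergodicity (`volume_compl_exists_mem_tower`).
-/

/-! ### Arcs of the circle in real coordinates -/

theorem mem_cIoo_coe_iff {a b : ℝ} (hab : a ≤ b) (hba : b < a + 1) (x : ℝ) :
    (x : S1) ∈ Set.cIoo (a : S1) (b : S1) ↔ toIocMod one_pos a x < b := by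
  have hb : toIcoMod (one_pos : (0 : ℝ) < 1) a b = b :=
    (toIcoMod_eq_self _).2 ⟨hab, hba⟩
  rw [Set.mem_cIoo, sbtw_iff_not_btw, btw_cyclic]
  have := QuotientAddGroup.btw_coe_iff (p := (1 : ℝ)) (hp' := ⟨one_pos⟩) (x₁ := a) (x₂ := b) (x₃ := x)
  rw [hb] at this
  exact (not_congr this).trans not_le

theorem cIoo_coe {a b : ℝ} (hab : a ≤ b) (hba : b < a + 1) :
    Set.cIoo (a : S1) (b : S1) = (fun t : ℝ => (t : S1)) '' Ioo a b := by
  ext y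
  obtain ⟨x, rfl⟩ := QuotientAddGroup.mk_surjective y
  have h := mem_cIoo_coe_iff hab hba x
  refine h.trans ⟨fun hx => ⟨toIocMod one_pos a x, ⟨left_lt_toIocMod _ _ _, hx⟩, ?_⟩, ?_⟩
  · have := self_sub_toIocDiv_zsmul (one_pos : (0 : ℝ) < 1) a x
    rw [← this]
    show ((x - _ : ℝ) : S1) = x
    rw [AddCircle.coe_sub]
    simp
  · rintro ⟨t, ht, hx⟩
    have h1 : (t : S1) ∈ Set.cIoo (a : S1) (b : S1) := by
      rw [mem_cIoo_coe_iff hab hba, (toIocMod_eq_self _).2 ⟨ht.1, by linarith [ht.2]⟩]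
      exact ht.2
    have h2 : (t : S1) = (x : S1) := hx
    rw [h2] at h1
    exact h.1 h1

theorem arcIoc_coe {a b : ℝ} (hab : a < b) (hba : b < a + 1) :
    arcIoc (a : S1) (b : S1) = (fun t : ℝ => (t : S1)) '' Ioc a b := by
  rw [arcIoc, cIoo_coe hab.le hba, ← Ioo_insert_right hab, image_insert_eq]

theorem coe_injOn_Ioc (a : ℝ) : InjOn (fun t : ℝ => (t : S1)) (Ioc a (a + 1)) :=
  fun _ hx _ hy h => (AddCircle.coe_eq_coe_iff_of_mem_Ioc (p := (1 : ℝ)) hx hy).1 h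

theorem coe_eq_coe_iff {s t : ℝ} : (s : S1) = (t : S1) ↔ ∃ m : ℤ, s = t + m := by
  rw [← sub_eq_zero, ← AddCircle.coe_sub, AddCircle.coe_eq_zero_iff]
  exact exists_congr fun m => by rw [zsmul_one, eq_comm, sub_eq_iff_eq_add']

theorem isOpenMap_coe : IsOpenMap (fun t : ℝ => (t : S1)) := QuotientAddGroup.isOpenMap_coe

theorem volume_image_coe {a : ℝ} {S : Set ℝ} (hS : S ⊆ Ioc a (a + 1))
    (ho : MeasurableSet ((fun t : ℝ => (t : S1)) '' S)) :
    volume ((fun t : ℝ => (t : S1)) '' S) = volume S := by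
  have hm := UnitAddCircle.measurePreserving_mk a
  rw [← hm.measure_preimage ho.nullMeasurableSet, Measure.restrict_apply (hm.measurable ho)]
  refine congrArg _ (Set.ext fun t => ⟨?_, fun ht => ⟨⟨t, ht, rfl⟩, hS ht⟩⟩)
  rintro ⟨⟨s, hs, hst⟩, ht⟩
  rwa [← coe_injOn_Ioc a (hS hs) ht hst]

theorem volume_image_Ioo {a b : ℝ} (hba : b ≤ a + 1) :
    volume ((fun t : ℝ => (t : S1)) '' Ioo a b) = ENNReal.ofReal (b - a) := by
  rw [volume_image_coe (fun t ht => ⟨ht.1, ht.2.le.trans hba⟩)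
    (isOpenMap_coe _ isOpen_Ioo).measurableSet, Real.volume_Ioo]

theorem volume_image_Ioc {a b : ℝ} (hab : a < b) (hba : b ≤ a + 1) :
    volume ((fun t : ℝ => (t : S1)) '' Ioc a b) = ENNReal.ofReal (b - a) := by
  rw [volume_image_coe (fun t ht => ⟨ht.1, ht.2.trans hba⟩), Real.volume_Ioc]
  rw [← Ioo_insert_right hab, image_insert_eq]
  exact (isOpenMap_coe _ isOpen_Ioo).measurableSet.insert _

/-! ### Conjugacy with the irrational rotation -/

theorem IsLift.bijective {F : CircleDeg1Lift} {f : S1 ≃ₜ S1} (hF : IsLift F f) :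
    Function.Bijective F := by
  refine ⟨fun s t hst => ?_, F.continuous_iff_surjective.1 hF.1⟩
  have h : (s : S1) = (t : S1) := f.injective (by rw [← hF.2, ← hF.2, hst])
  obtain ⟨m, rfl⟩ := coe_eq_coe_iff.1 h
  rw [F.map_add_int] at hst
  linarith

/-- The range is stable under translation by τ and by 1, which generate a dense group. A monotone
map with dense range is continuous, which is the use made of this. -/
theorem dense_range_of_semiconj {F H : CircleDeg1Lift} (hF : Function.Surjective F) {τ : ℝ}
    (hτ : Irrational τ) (hH : ∀ t, H (F t) = H t + τ) : DenseRange H := by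
  have hd : Dense (AddSubgroup.closure {τ, 1} : Set ℝ) :=
    dense_addSubgroupClosure_pair_iff.2 (by simpa using hτ)
  -- Both signs are carried through the induction, so that negation merely swaps them.
  have key : ∀ z ∈ AddSubgroup.closure {τ, (1 : ℝ)},
      ∀ t, (∃ t', H t' = H t + z) ∧ ∃ t', H t' = H t - z := by
    intro z hz
    induction hz using AddSubgroup.closure_induction with
    | mem z hz =>
      intro t
      rcases hz with rfl | rfl
      · refine ⟨⟨F t, hH t⟩, ?_⟩
        obtain ⟨t', rfl⟩ := hF t
        exact ⟨t', by rw [hH]; ring⟩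
      · exact ⟨⟨t + 1, H.map_add_one t⟩, ⟨t - 1, by simpa using H.map_sub_int t 1⟩⟩
    | zero => exact fun t => ⟨⟨t, by simp⟩, ⟨t, by simp⟩⟩
    | add z w _ _ hz hw =>
      intro t
      obtain ⟨t₁, h₁⟩ := (hz t).1
      obtain ⟨t₂, h₂⟩ := (hw t₁).1
      obtain ⟨t₃, h₃⟩ := (hz t).2
      obtain ⟨t₄, h₄⟩ := (hw t₃).2
      exact ⟨⟨t₂, by rw [h₂, h₁]; ring⟩, ⟨t₄, by rw [h₄, h₃]; ring⟩⟩
    | neg z _ hz =>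
      intro t
      refine ⟨?_, ?_⟩
      · simpa [sub_eq_add_neg] using (hz t).2
      · simpa using (hz t).1
  have hd' : Dense ((fun z => H 0 + z) '' (AddSubgroup.closure {τ, 1} : Set ℝ)) :=
    (AddGroup.addLeft_bijective (H 0)).surjective.denseRange.dense_image
      (continuous_const.add continuous_id) hd
  refine hd'.mono ?_
  rintro _ ⟨z, hz, rfl⟩
  exact (key z hz 0).1

theorem exists_lift_orbit {F H : CircleDeg1Lift} {f : S1 ≃ₜ S1} (hF : IsLift F f) {τ : ℝ}
    (hH : ∀ t, H (F t) = H t + τ) (n : ℤ) (t : ℝ) :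
    ∃ s : ℝ, (s : S1) = (f ^ n) (t : S1) ∧ H s = H t + n * τ := by
  induction n using Int.induction_on with
  | zero => exact ⟨t, by simp, by simp⟩
  | succ n ih =>
    obtain ⟨s, hs, hs'⟩ := ih
    refine ⟨F s, ?_, by rw [hH, hs']; push_cast; ring⟩
    rw [hF.2, hs, add_comm, zpow_add, zpow_one]
    rfl
  | pred n ih =>
    obtain ⟨s, hs, hs'⟩ := ih
    obtain ⟨r, rfl⟩ := hF.bijective.2 s
    refine ⟨r, f.injective ?_, by rw [hH] at hs'; push_cast at hs' ⊢; linarith⟩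
    rw [← hF.2, hs, sub_eq_add_neg, add_comm (-(n : ℤ)), zpow_add, zpow_neg_one]
    exact (f.apply_symm_apply _).symm

/-- If H were constant on [a, b], the orbit of an interior point c would return to this interval;
comparing values of H gives nτ ∈ ℤ for the return time n, so n = 0 by irrationality. Aiming the
return at (a, c), which omits c, excludes n = 0. -/
theorem strictMono_of_minimal {F H : CircleDeg1Lift} {f : S1 ≃ₜ S1} (hF : IsLift F f)
    (hf : MinimalHomeo f) {τ : ℝ} (hτ : Irrational τ) (hH : ∀ t, H (F t) = H t + τ) :
    StrictMono H := by
  refine H.monotone.strictMono_of_injective ?_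
  suffices h : ∀ a b, a < b → H a ≠ H b by
    intro a b hab
    by_contra hne
    rcases lt_or_gt_of_ne hne with hlt | hlt
    · exact h a b hlt hab
    · exact h b a hlt hab.symm
  intro a b hab heq
  have hba : b < a + 1 := by
    by_contra! hle
    have := H.monotone hle
    rw [H.map_add_one] at this
    linarith
  have hconst : ∀ t ∈ Icc a b, H t = H a := fun t ht =>
    le_antisymm ((H.monotone ht.2).trans heq.ge) (H.monotone ht.1)
  set c := (a + b) / 2 with hc
  have hac : a < c := by linarith
  have hcb : c < b := by linarith
  obtain ⟨n, u, hu, hn⟩ := DenseRange.exists_mem_open (hf (c : S1))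
    (isOpenMap_coe _ (isOpen_Ioo (a := a) (b := c))) ((nonempty_Ioo.2 hac).image _)
  obtain ⟨s, hs, hs'⟩ := exists_lift_orbit hF hH n c
  obtain ⟨m, rfl⟩ := coe_eq_coe_iff.1 (hs.trans hn.symm)
  rw [H.map_add_int, hconst u ⟨hu.1.le, (hu.2.trans hcb).le⟩, hconst c ⟨hac.le, hcb.le⟩] at hs'
  have hn0 : n = 0 := by
    by_contra hn0
    exact (hτ.intCast_mul hn0).ne_int m (by linarith)
  subst hn0
  have : u = c := coe_injOn_Ioc a ⟨hu.1, by linarith [hu.2]⟩ ⟨hac, by linarith⟩ (by simpa using hn)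
  exact hu.2.ne this

/-- A strictly monotone continuous lift of degree one descends to a circle homeomorphism. -/
theorem exists_homeo_of_lift (H : CircleDeg1Lift) (hc : Continuous H) (hm : StrictMono H) :
    ∃ h : S1 ≃ₜ S1, ∀ t : ℝ, h (t : S1) = ((H t : ℝ) : S1) := by
  have hper : Function.Periodic (fun t : ℝ => ((H t : ℝ) : S1)) 1 := by
    intro t
    simp [H.map_add_one]
  have hsurj : Function.Surjective H := H.continuous_iff_surjective.1 hc
  have hcont : Continuous (hper.lift : S1 → S1) := by
    refine (QuotientAddGroup.isQuotientMap_mk (N := AddSubgroup.zmultiples (1 : ℝ))).continuous_iff.2 ?_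
    exact (AddCircle.continuous_mk' 1).comp hc
  have hbij : Function.Bijective (hper.lift : S1 → S1) := by
    constructor
    · intro y z hyz
      obtain ⟨s, rfl⟩ := QuotientAddGroup.mk_surjective y
      obtain ⟨t, rfl⟩ := QuotientAddGroup.mk_surjective z
      have hyz' : ((H s : ℝ) : S1) = ((H t : ℝ) : S1) := hyz
      obtain ⟨m, hm'⟩ := coe_eq_coe_iff.1 hyz'
      rw [← H.map_add_int] at hm'
      exact coe_eq_coe_iff.2 ⟨m, hm.injective hm'⟩
    · intro y
      obtain ⟨s, rfl⟩ := QuotientAddGroup.mk_surjective y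
      obtain ⟨t, rfl⟩ := hsurj s
      exact ⟨(t : S1), rfl⟩
  exact ⟨Continuous.homeoOfEquivCompactToT2 (f := Equiv.ofBijective _ hbij) hcont, fun t => rfl⟩

theorem mem_cIoo_iff_of_lift {H : CircleDeg1Lift} (hc : Continuous H) (hm : StrictMono H)
    {h : S1 ≃ₜ S1} (hh : ∀ t : ℝ, h (t : S1) = ((H t : ℝ) : S1)) (a b c : S1) :
    c ∈ Set.cIoo a b ↔ h c ∈ Set.cIoo (h a) (h b) := by
  obtain ⟨a, rfl⟩ := QuotientAddGroup.mk_surjective a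
  obtain ⟨b, hb, rfl⟩ : ∃ t ∈ Ico a (a + 1), (t : S1) = b :=
    ⟨_, (AddCircle.equivIco 1 a b).2, AddCircle.coe_equivIco⟩
  change c ∈ Set.cIoo (a : S1) (b : S1) ↔ h c ∈ Set.cIoo (h (a : S1)) (h (b : S1))
  rw [hh, hh, cIoo_coe hb.1 hb.2, cIoo_coe (H.monotone hb.1)
    (by rw [← H.map_add_one]; exact hm hb.2)]
  constructor
  · rintro ⟨t, ht, rfl⟩
    exact ⟨H t, ⟨hm ht.1, hm ht.2⟩, (hh t).symm⟩
  · rintro ⟨s, hs, hsc⟩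
    obtain ⟨t, rfl⟩ := H.continuous_iff_surjective.1 hc s
    exact ⟨t, ⟨hm.lt_iff_lt.1 hs.1, hm.lt_iff_lt.1 hs.2⟩, h.injective ((hh t).trans hsc)⟩

/-- A minimal orientation preserving homeomorphism with irrational rotation number is conjugate to
the rotation, by a homeomorphism that preserves the cyclic order. -/
theorem exists_conj_rotation {f : S1 ≃ₜ S1} (ho : OrientationPreserving f) (hf : MinimalHomeo f)
    (hirr : Irrational (rotationNumber f)) :
    ∃ h : S1 ≃ₜ S1, (∀ y, h (f y) = h y + (rotationNumber f : S1)) ∧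
      ∀ a b c, c ∈ Set.cIoo a b ↔ h c ∈ Set.cIoo (h a) (h b) := by
  obtain ⟨F, hF⟩ := ho
  have hrot := rotationNumber_eq hF
  set τ := CircleDeg1Lift.translationNumber F with hτ
  have hfl : rotationNumber f = τ - ⌊τ⌋ := hrot
  have hτirr : Irrational τ := by
    have : τ = rotationNumber f + ⌊τ⌋ := by rw [hfl]; ring
    rw [this]
    exact hirr.add_intCast _
  -- Poincaré: bijective lifts with equal translation numbers are semiconjugate by a monotone map of
  -- degree one. Irrationality then gives continuity, and minimality injectivity.
  obtain ⟨H, hH⟩ := CircleDeg1Lift.semiconj_of_bijective_of_translationNumber_eq hF.bijective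
    (f₂ := (CircleDeg1Lift.translate (Multiplicative.ofAdd τ) : CircleDeg1Lift))
    (CircleDeg1Lift.isUnit_iff_bijective.1 (Units.isUnit _))
    (by rw [CircleDeg1Lift.translationNumber_translate])
  have hH' : ∀ t, H (F t) = H t + τ := fun t => by
    rw [hH t, CircleDeg1Lift.translate_apply, add_comm]
  have hm := strictMono_of_minimal hF hf hτirr hH'
  have hc := H.monotone.continuous_of_denseRange
    (dense_range_of_semiconj hF.bijective.2 hτirr hH')
  obtain ⟨h, hh⟩ := exists_homeo_of_lift H hc hm
  refine ⟨h, fun y => ?_, fun a b c => mem_cIoo_iff_of_lift hc hm hh a b c⟩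
  obtain ⟨t, rfl⟩ := QuotientAddGroup.mk_surjective y
  change h (f (t : S1)) = h (t : S1) + _
  rw [← hF.2, hh, hh, hH', hfl, ← AddCircle.coe_add, coe_eq_coe_iff]
  exact ⟨⌊τ⌋, by ring⟩

theorem mem_cIoo_add_const (a b c d : S1) :
    c ∈ Set.cIoo a b ↔ c + d ∈ Set.cIoo (a + d) (b + d) := by
  obtain ⟨d, rfl⟩ := QuotientAddGroup.mk_surjective d
  have := mem_cIoo_iff_of_lift
    (H := (CircleDeg1Lift.translate (Multiplicative.ofAdd d) : CircleDeg1Lift))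
    (by exact continuous_const_add d)
    (fun s t hst => by simpa using hst) (h := Homeomorph.addRight (d : S1))
    (fun t => by simp [add_comm]) a b c
  simpa using this

/-! ### Unique ergodicity of the irrational rotation -/

theorem denseRange_zsmul_of_irrational {ρ : ℝ} (hρ : Irrational ρ) :
    DenseRange fun n : ℤ => n • (ρ : S1) :=
  AddCircle.denseRange_zsmul_coe_iff.2 (by simpa using hρ)

/-- The integral of a continuous function translated by c is continuous in c and constant on the
dense set ℤρ, hence constant. So ν is invariant under all translations, and uniqueness of Haar
measure applies. -/
theorem eq_volume_of_rotation_invariant {ρ : ℝ} (hρ : Irrational ρ) (ν : Measure S1)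
    [IsProbabilityMeasure ν] (hν : ν.map (fun y => y + (ρ : S1)) = ν) : ν = volume := by
  have h1 : ∀ c : S1, ν.map (fun y => y + c) = ν := by
    have hcont : ∀ (φ : C(S1, ℝ)), Continuous fun c : S1 => ∫ y, φ (y + c) ∂ν := by
      intro φ
      refine continuous_of_dominated (bound := fun _ => ‖φ‖) ?_ ?_ ?_ ?_
      · exact fun c => (φ.continuous.comp (continuous_add_const c)).aestronglyMeasurable
      · exact fun c => Filter.Eventually.of_forall fun y => φ.norm_coe_le_norm _
      · exact integrable_const _
      · exact Filter.Eventually.of_forall fun y => φ.continuous.comp (continuous_const.add continuous_id)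
    have hmeas : ∀ c : S1, Measurable fun y : S1 => y + c := fun c => measurable_add_const c
    have hz : ∀ n : ℤ, ν.map (fun y => y + n • (ρ : S1)) = ν := by
      intro n
      induction n using Int.induction_on with
      | zero => simp
      | succ n ih =>
        have : (fun y : S1 => y + ((n : ℤ) + 1) • (ρ : S1)) =
            (fun y => y + (ρ : S1)) ∘ fun y => y + (n : ℤ) • (ρ : S1) := by
          funext y; simp only [Function.comp, add_zsmul, one_zsmul, add_assoc]
        rw [this, ← Measure.map_map (hmeas _) (hmeas _), ih, hν]
      | pred n ih =>
        have : (fun y : S1 => y + (-(n : ℤ)) • (ρ : S1)) =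
            (fun y => y + (-(n : ℤ) - 1) • (ρ : S1)) ∘ fun y => y + (ρ : S1) := by
          funext y; simp only [Function.comp, sub_zsmul, one_zsmul]; abel
        rw [this, ← Measure.map_map (hmeas _) (hmeas _), hν] at ih
        exact ih
    intro c
    have : IsProbabilityMeasure (ν.map fun y => y + c) :=
      Measure.isProbabilityMeasure_map (hmeas c).aemeasurable
    refine ext_of_forall_integral_eq_of_IsFiniteMeasure fun φ => ?_
    have heq : (fun c : S1 => ∫ y, φ.toContinuousMap (y + c) ∂ν) = fun _ => ∫ y, φ.toContinuousMap y ∂ν := by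
      refine (denseRange_zsmul_of_irrational hρ).equalizer (hcont _) continuous_const ?_
      funext n
      have := integral_map (μ := ν) (hmeas (n • (ρ : S1))).aemeasurable
        (f := φ.toContinuousMap) φ.continuous.aestronglyMeasurable
      rw [hz n] at this
      exact this.symm
    rw [integral_map (hmeas c).aemeasurable φ.continuous.aestronglyMeasurable]
    exact congrFun heq c
  have : ν.IsAddLeftInvariant := ⟨fun c => by simpa only [add_comm c] using h1 c⟩
  have : ν.IsAddHaarMeasure := Measure.isAddHaarMeasure_of_isCompact_nonempty_interior ν univ
    isCompact_univ (by simp) (by simp) (by simp)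
  have : IsProbabilityMeasure (volume : Measure S1) := ⟨UnitAddCircle.measure_univ⟩
  exact Measure.isAddHaarMeasure_eq_of_isProbabilityMeasure _ _

/-! ### Arithmetic of continued fractions -/

/-- The lengths `δₙ = ρ G(ρ) ⋯ Gⁿ(ρ)` of the dynamical intervals of the rotation by `ρ`. -/
noncomputable def gap (ρ : ℝ) : ℕ → ℝ
  | 0 => ρ
  | n + 1 => gap ρ n * gauss^[n + 1] ρ

/-- The signed displacement `(-1)ⁿ δₙ` of the origin by `qₙ` steps of the rotation by `ρ`. -/
noncomputable def signedGap (ρ : ℝ) (n : ℕ) : ℝ := (-1) ^ n * gap ρ n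

/-- The numerators `pₙ` belonging to the denominators `qₙ = returnTime ρ n`. -/
noncomputable def winding (ρ : ℝ) : ℕ → ℤ
  | 0 => 0
  | 1 => 1
  | n + 2 => partialQuotient ρ (n + 1) * winding ρ (n + 1) + winding ρ n

section

variable {ρ : ℝ}

theorem irrational_gauss (h : Irrational ρ) : Irrational (gauss ρ) := by
  have : gauss ρ = ρ⁻¹ - (⌊1 / ρ⌋ : ℤ) := by rw [gauss, Int.fract, one_div]
  rw [this]
  exact h.inv.sub_intCast _

theorem gauss_mem_Ioo (h : Irrational ρ) : gauss ρ ∈ Ioo (0 : ℝ) 1 :=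
  ⟨lt_of_le_of_ne (Int.fract_nonneg _) fun h0 => (irrational_gauss h).ne_zero h0.symm,
    Int.fract_lt_one _⟩

theorem irrational_gauss_iterate (h : Irrational ρ) (n : ℕ) : Irrational (gauss^[n] ρ) := by
  induction n with
  | zero => exact h
  | succ n ih => rw [Function.iterate_succ_apply']; exact irrational_gauss ih

theorem gauss_iterate_mem_Ioo (h : Irrational ρ) (h01 : ρ ∈ Ioo (0 : ℝ) 1) (n : ℕ) :
    gauss^[n] ρ ∈ Ioo (0 : ℝ) 1 := by
  cases n with
  | zero => exact h01
  | succ n =>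
    rw [Function.iterate_succ_apply']
    exact gauss_mem_Ioo (irrational_gauss_iterate h n)

variable (h : Irrational ρ) (h01 : ρ ∈ Ioo (0 : ℝ) 1)
include h h01

theorem gauss_iterate_pos (n : ℕ) : 0 < gauss^[n] ρ := (gauss_iterate_mem_Ioo h h01 n).1

theorem gauss_iterate_lt_one (n : ℕ) : gauss^[n] ρ < 1 := (gauss_iterate_mem_Ioo h h01 n).2

theorem one_div_gauss_iterate (n : ℕ) :
    1 / gauss^[n] ρ = partialQuotient ρ n + gauss^[n + 1] ρ := by
  have h0 := gauss_iterate_pos h h01 n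
  rw [Function.iterate_succ_apply', gauss, partialQuotient,
    natCast_floor_eq_intCast_floor (by positivity), Int.floor_add_fract]

theorem partialQuotient_mul_add (n : ℕ) :
    partialQuotient ρ n * gauss^[n] ρ + gauss^[n + 1] ρ * gauss^[n] ρ = 1 := by
  rw [← add_mul, ← one_div_gauss_iterate h h01, one_div_mul_cancel (gauss_iterate_pos h h01 n).ne']

theorem one_le_partialQuotient (n : ℕ) : 1 ≤ partialQuotient ρ n :=
  Nat.le_floor (by
    rw [Nat.cast_one]
    exact (one_le_div (gauss_iterate_pos h h01 n)).2 (gauss_iterate_lt_one h h01 n).le)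

theorem gap_pos (n : ℕ) : 0 < gap ρ n := by
  induction n with
  | zero => exact h01.1
  | succ n ih => exact mul_pos ih (gauss_iterate_pos h h01 _)

theorem gap_succ_lt (n : ℕ) : gap ρ (n + 1) < gap ρ n :=
  mul_lt_of_lt_one_right (gap_pos h h01 n) (gauss_iterate_lt_one h h01 _)

theorem gap_lt_one (n : ℕ) : gap ρ n < 1 := by
  induction n with
  | zero => exact h01.2
  | succ n ih => exact (gap_succ_lt h h01 n).trans ih

theorem gap_add_two (n : ℕ) :
    gap ρ (n + 2) = gap ρ n - partialQuotient ρ (n + 1) * gap ρ (n + 1) := by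
  simp only [gap]
  linear_combination gap ρ n * partialQuotient_mul_add h h01 (n + 1)

theorem gap_add_le (n : ℕ) : gap ρ (n + 1) + gap ρ (n + 2) ≤ gap ρ n := by
  have h1 : (1 : ℝ) ≤ partialQuotient ρ (n + 1) := by
    exact_mod_cast one_le_partialQuotient h h01 (n + 1)
  have := le_mul_of_one_le_left (gap_pos h h01 (n + 1)).le h1
  rw [gap_add_two h h01]
  linarith

/-- Telescoping through δₙ₊₂ ≤ δₙ − δₙ₊₁. This supplies the Borel–Cantelli hypothesis for the top
storeys. -/
theorem summable_gap : Summable (gap ρ) := by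
  rw [← summable_nat_add_iff 2]
  refine summable_of_sum_range_le (c := gap ρ 0) (fun n => (gap_pos h h01 _).le) fun n => ?_
  calc ∑ i ∈ Finset.range n, gap ρ (i + 2)
      ≤ ∑ i ∈ Finset.range n, (gap ρ i - gap ρ (i + 1)) :=
        Finset.sum_le_sum fun i _ => by linarith [gap_add_le h h01 i]
    _ = gap ρ 0 - gap ρ n := Finset.sum_range_sub' _ _
    _ ≤ gap ρ 0 := by linarith [gap_pos h h01 n]

theorem signedGap_eq (n : ℕ) : signedGap ρ n = returnTime ρ n * ρ - winding ρ n := by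
  induction n using Nat.twoStepInduction with
  | zero => simp [signedGap, gap, returnTime, winding]
  | one =>
    have := partialQuotient_mul_add h h01 0
    simp only [Function.iterate_zero, id_eq] at this
    simp only [signedGap, gap, returnTime, winding]
    push_cast
    linarith
  | more n ih ih' =>
    have e : signedGap ρ (n + 2) =
        signedGap ρ n + partialQuotient ρ (n + 1) * signedGap ρ (n + 1) := by
      simp only [signedGap, gap_add_two h h01]
      ring
    rw [e, ih, ih']
    simp only [returnTime, winding]
    push_cast
    ring

omit h h01 in
theorem returnTime_mul_winding (n : ℕ) :
    (returnTime ρ n : ℤ) * winding ρ (n + 1) - returnTime ρ (n + 1) * winding ρ n = (-1) ^ n := by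
  induction n with
  | zero => simp [returnTime, winding]
  | succ n ih =>
    rw [pow_succ, ← ih]
    simp only [returnTime, winding]
    push_cast
    ring

/-- The determinant identity for consecutive convergents, rewritten in gaps: the long and short
towers have total length one. -/
theorem returnTime_mul_gap_add (n : ℕ) :
    returnTime ρ (n + 1) * gap ρ n + returnTime ρ n * gap ρ (n + 1) = 1 := by
  have h1 := signedGap_eq h h01 n
  have h2 := signedGap_eq h h01 (n + 1)
  have h3 : (returnTime ρ n : ℝ) * winding ρ (n + 1) - returnTime ρ (n + 1) * winding ρ n
      = (-1) ^ n := by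
    exact_mod_cast returnTime_mul_winding (ρ := ρ) n
  have h4 : ((-1 : ℝ) ^ n) * (-1) ^ n = 1 := by rw [← mul_pow]; simp
  rw [signedGap] at h1 h2
  rw [pow_succ] at h2
  linear_combination (-1 : ℝ) ^ n * (returnTime ρ (n + 1) * h1 - returnTime ρ n * h2 + h3) +
    (1 - returnTime ρ (n + 1) * gap ρ n - returnTime ρ n * gap ρ (n + 1)) * h4

theorem one_le_returnTime (n : ℕ) : 1 ≤ returnTime ρ n := by
  induction n using Nat.twoStepInduction with
  | zero => simp [returnTime]
  | one => exact one_le_partialQuotient h h01 0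
  | more n ih ih' => exact le_add_left ih

theorem returnTime_le_succ (n : ℕ) : returnTime ρ n ≤ returnTime ρ (n + 1) := by
  cases n with
  | zero => exact one_le_partialQuotient h h01 0
  | succ n =>
    exact (Nat.le_mul_of_pos_left _ (one_le_partialQuotient h h01 (n + 1))).trans
      (Nat.le_add_right _ _)

theorem half_le_returnTime_mul_gap (n : ℕ) : 1 / 2 ≤ returnTime ρ (n + 1) * gap ρ n := by
  have h1 : (returnTime ρ n : ℝ) ≤ returnTime ρ (n + 1) := by
    exact_mod_cast returnTime_le_succ h h01 n
  have h2 := gap_pos h h01 n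
  have h3 : (returnTime ρ n : ℝ) * gap ρ (n + 1) ≤ returnTime ρ (n + 1) * gap ρ n :=
    mul_le_mul h1 (gap_succ_lt h h01 n).le (gap_pos h h01 _).le (by positivity)
  linarith [returnTime_mul_gap_add h h01 n]

theorem returnTime_succ_mul_le (n : ℕ) :
    returnTime ρ (n + 1) * gauss^[n] ρ ≤ 2 * returnTime ρ n := by
  have h1 := partialQuotient_mul_add h h01 n
  have h2 := mul_pos (gauss_iterate_pos h h01 (n + 1)) (gauss_iterate_pos h h01 n)
  cases n with
  | zero => simp only [returnTime, Nat.cast_one] at *; linarith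
  | succ n =>
    have h3 : (returnTime ρ n : ℝ) ≤ returnTime ρ (n + 1) := by
      exact_mod_cast returnTime_le_succ h h01 n
    have h4 := gauss_iterate_lt_one h h01 (n + 1)
    have h5 : (returnTime ρ n : ℝ) * gauss^[n + 1] ρ ≤ returnTime ρ (n + 1) * 1 :=
      mul_le_mul h3 h4.le (gauss_iterate_pos h h01 _).le (by positivity)
    have h6 : (partialQuotient ρ (n + 1) * gauss^[n + 1] ρ) * returnTime ρ (n + 1) ≤
        1 * returnTime ρ (n + 1) := mul_le_mul_of_nonneg_right (by linarith) (by positivity)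
    simp only [returnTime]
    push_cast
    linarith

/-- Unlike the long tower, the short one can be arbitrarily thin; two consecutive Gauss iterates
away from 0 prevent this. One factor 1/2 comes from qₙ₊₁Gⁿ(ρ) ≤ 2qₙ, the other from qₙ₊₁δₙ ≥ 1/2. -/
theorem le_returnTime_mul_gap_succ (n : ℕ) :
    gauss^[n] ρ * gauss^[n + 1] ρ / 4 ≤ returnTime ρ n * gap ρ (n + 1) := by
  have h1 := half_le_returnTime_mul_gap h h01 n
  have h2 := returnTime_succ_mul_le h h01 n
  have h3 := gap_pos h h01 (n + 1)
  have h4 := mul_pos (gauss_iterate_pos h h01 n) (gauss_iterate_pos h h01 (n + 1))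
  have h5 := mul_le_mul_of_nonneg_right h2 h3.le
  have h6 := mul_le_mul_of_nonneg_left h1 h4.le
  simp only [gap] at *
  linarith

/-! ### Separation of rotation orbits and disjointness of the towers -/

-- Consecutive vectors (qₙ, pₙ) form a basis of ℤ², their determinant being ±1; the witnesses are
-- Cramer's rule.
omit h h01 in
theorem exists_int_combination (n : ℕ) (k m : ℤ) :
    ∃ A B : ℤ, k = A * returnTime ρ n + B * returnTime ρ (n + 1) ∧
      m = A * winding ρ n + B * winding ρ (n + 1) := by
  have h1 := returnTime_mul_winding (ρ := ρ) n
  have h4 : ((-1 : ℤ) ^ n) * (-1) ^ n = 1 := by rw [← mul_pow]; simp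
  refine ⟨(-1) ^ n * (k * winding ρ (n + 1) - m * returnTime ρ (n + 1)),
    (-1) ^ n * (m * returnTime ρ n - k * winding ρ n), ?_, ?_⟩
  · linear_combination (-k * (-1) ^ n) * h1 - k * h4
  · linear_combination (-m * (-1) ^ n) * h1 - m * h4

theorem exists_gap_combination (n : ℕ) (k m : ℤ) :
    ∃ A B : ℤ, k = A * returnTime ρ n + B * returnTime ρ (n + 1) ∧
      k * ρ - m = (-1) ^ n * (A * gap ρ n - B * gap ρ (n + 1)) := by
  obtain ⟨A, B, hk, hm⟩ := exists_int_combination (ρ := ρ) n k m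
  refine ⟨A, B, hk, ?_⟩
  have h1 := signedGap_eq h h01 n
  have h2 := signedGap_eq h h01 (n + 1)
  rw [signedGap] at h1 h2
  rw [pow_succ] at h2
  rw [hk, hm]
  push_cast
  linear_combination (-A : ℝ) * h1 - B * h2

/-- The first `qₙ₊₁` multiples of `ρ` are `δₙ`-separated modulo one. -/
theorem gap_le_abs_of_pos_lt {n : ℕ} {k m : ℤ} (hk : 0 < k) (hkq : k < returnTime ρ (n + 1)) :
    gap ρ n ≤ |k * ρ - m| := by
  obtain ⟨A, B, hAB, hv⟩ := exists_gap_combination h h01 n k m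
  have hd := gap_pos h h01 n
  have hd' := gap_pos h h01 (n + 1)
  have hq : (1 : ℤ) ≤ returnTime ρ n := by exact_mod_cast one_le_returnTime h h01 n
  have hq' : (1 : ℤ) ≤ returnTime ρ (n + 1) := by exact_mod_cast one_le_returnTime h h01 (n + 1)
  rw [hv, abs_mul, abs_pow, abs_neg, abs_one, one_pow, one_mul]
  by_contra! hlt
  rw [abs_lt] at hlt
  -- A displacement below δₙ forces B to share the sign of A when A ≠ 0, so that k is negative or
  -- larger than qₙ₊₁; when A = 0, k is a multiple of qₙ₊₁.
  rcases lt_trichotomy A 0 with hA | hA | hA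
  · have hA' : (A : ℝ) + 1 ≤ 0 := by exact_mod_cast hA
    have hB : (B : ℝ) * gap ρ (n + 1) < 0 := by nlinarith
    have hB' : B < 0 := by
      have : (B : ℝ) < 0 := by by_contra! hc; nlinarith
      exact_mod_cast this
    nlinarith
  · subst hA
    rw [zero_mul, zero_add] at hAB
    have hB : 0 < B := by by_contra! hc; nlinarith
    nlinarith
  · have hA' : (1 : ℝ) ≤ A := by exact_mod_cast hA
    have hB : 0 < (B : ℝ) * gap ρ (n + 1) := by nlinarith
    have hB' : 0 < B := by
      have : 0 < (B : ℝ) := by by_contra! hc; nlinarith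
      exact_mod_cast this
    nlinarith

theorem gap_le_abs {n : ℕ} {k m : ℤ} (hk0 : k ≠ 0) (hk : |k| < returnTime ρ (n + 1)) :
    gap ρ n ≤ |k * ρ - m| := by
  rw [abs_lt] at hk
  rcases lt_or_gt_of_ne hk0 with hneg | hpos
  · have := gap_le_abs_of_pos_lt h h01 (n := n) (k := -k) (m := -m) (by omega) (by omega)
    rw [← abs_neg]
    convert this using 2
    push_cast
    ring
  · exact gap_le_abs_of_pos_lt h h01 hpos hk.2

/-- Distinct storeys have base points at least δₙ apart, while θ and θ' differ by less than 1. Hence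
one parameter must be interior: closed storeys may share endpoints. The scale c is free so that both
towers are covered. -/
theorem tower_position_unique {n i i' : ℕ} (hi : i < returnTime ρ (n + 1))
    (hi' : i' < returnTime ρ (n + 1)) {c θ θ' : ℝ} (hc0 : c ≠ 0) (hc : |c| ≤ gap ρ n)
    (hθ : θ ∈ Ioo (0 : ℝ) 1) (hθ' : θ' ∈ Icc (0 : ℝ) 1)
    (heq : ((i * ρ + θ * c : ℝ) : S1) = ((i' * ρ + θ' * c : ℝ) : S1)) : i = i' ∧ θ = θ' := by
  obtain ⟨m, hm⟩ := coe_eq_coe_iff.1 heq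
  have hθθ : |θ' - θ| < 1 := by
    rw [abs_lt]
    exact ⟨by linarith [hθ.2, hθ'.1], by linarith [hθ.1, hθ'.2]⟩
  have hlt : |(θ' - θ) * c| < gap ρ n := by
    rw [abs_mul]
    calc |θ' - θ| * |c| < 1 * |c| := mul_lt_mul_of_pos_right hθθ (abs_pos.2 hc0)
      _ ≤ gap ρ n := by rwa [one_mul]
  have hii : i = i' := by
    by_contra hne
    have h1 : (((i : ℤ) - i' : ℤ) : ℝ) * ρ - m = (θ' - θ) * c := by push_cast; linarith
    have := gap_le_abs h h01 (n := n) (k := (i : ℤ) - i') (m := m) (by omega)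
      (by rw [abs_lt]; omega)
    rw [h1] at this
    linarith
  subst hii
  refine ⟨rfl, ?_⟩
  have h1 : (θ' - θ) * c = -m := by linarith
  have h2 : m = 0 := by
    rw [h1, abs_neg] at hlt
    have : |m| < 1 := by exact_mod_cast hlt.trans (gap_lt_one h h01 n)
    exact Int.abs_lt_one_iff.1 this
  rw [h2, Int.cast_zero, neg_zero, mul_eq_zero] at h1
  linarith [h1.resolve_right hc0]

/-- A common point gives Bδₙ₊₁ − Aδₙ = θδₙ + θ'δₙ₊₁ with i − j = Aqₙ + Bqₙ₊₁. The bounds on the sum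
then push i − j out of (−qₙ, qₙ₊₁), whatever the sign of A. Bounding only the sum allows one of θ,
θ' to be an endpoint. -/
theorem tower_position_disjoint {n i j : ℕ} (hi : i < returnTime ρ (n + 1))
    (hj : j < returnTime ρ n) {θ θ' : ℝ} (hpos : 0 < θ * gap ρ n + θ' * gap ρ (n + 1))
    (hlt : θ * gap ρ n + θ' * gap ρ (n + 1) < gap ρ n + gap ρ (n + 1)) :
    ((i * ρ + θ * signedGap ρ n : ℝ) : S1) ≠ ((j * ρ + θ' * signedGap ρ (n + 1) : ℝ) : S1) := by
  intro heq
  obtain ⟨m, hm⟩ := coe_eq_coe_iff.1 heq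
  obtain ⟨A, B, hAB, hv⟩ := exists_gap_combination h h01 n ((i : ℤ) - j) m
  have hd := gap_pos h h01 n
  have hd' := gap_pos h h01 (n + 1)
  have hq : (1 : ℤ) ≤ returnTime ρ n := by exact_mod_cast one_le_returnTime h h01 n
  have hq' : (1 : ℤ) ≤ returnTime ρ (n + 1) := by exact_mod_cast one_le_returnTime h h01 (n + 1)
  have h4 : ((-1 : ℝ) ^ n) * (-1) ^ n = 1 := by rw [← mul_pow]; simp
  have hw : B * gap ρ (n + 1) - A * gap ρ n = θ * gap ρ n + θ' * gap ρ (n + 1) := by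
    simp only [signedGap, pow_succ] at hm
    push_cast at hv
    linear_combination (-(-1) ^ n : ℝ) * hm + (-1 : ℝ) ^ n * hv +
      (θ * gap ρ n + θ' * gap ρ (n + 1) - (B * gap ρ (n + 1) - A * gap ρ n)) * h4
  rw [← hw] at hpos hlt
  have hk1 : (i : ℤ) - j < returnTime ρ (n + 1) := by omega
  have hk2 : -(returnTime ρ n : ℤ) < (i : ℤ) - j := by omega
  rw [hAB] at hk1 hk2
  rcases lt_trichotomy A 0 with hA | hA | hA
  · have hA' : (A : ℝ) + 1 ≤ 0 := by exact_mod_cast hA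
    have hB' : B < 1 := by
      have : (B : ℝ) < 1 := by by_contra! hc; nlinarith
      exact_mod_cast this
    nlinarith
  · subst hA
    have hB' : 0 < B := by
      have : 0 < (B : ℝ) := by
        by_contra! hc
        rw [Int.cast_zero, zero_mul, sub_zero] at hpos
        nlinarith
      exact_mod_cast this
    nlinarith
  · have hA' : (1 : ℝ) ≤ A := by exact_mod_cast hA
    have hB' : 0 < B := by
      have : 0 < (B : ℝ) := by by_contra! hc; nlinarith
      exact_mod_cast this
    nlinarith

end

/-! ### Density of almost every orbit of the Gauss map -/

/-- Irrational numbers in `(0, 1)` whose orbit under the Gauss map is dense. -/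
def gaussGeneric : Set ℝ :=
  {ρ | Irrational ρ ∧ ρ ∈ Ioo (0 : ℝ) 1 ∧
    ∀ c d : ℚ, 0 < c → c < d → d < 1 → ∃ n, gauss^[n] ρ ∈ Icc (c : ℝ) d}

theorem gauss_one_div_add {a : ℕ} {s : ℝ} (hs : s ∈ Ioo (0 : ℝ) 1) : gauss (1 / (a + s)) = s := by
  rw [gauss, one_div_one_div, Int.fract_natCast_add]
  exact Int.fract_eq_self.2 ⟨hs.1.le, hs.2⟩

/-- The inverse branch of `Gⁿ` through an irrational number is a Möbius transformation. -/
theorem exists_inverse_branch {ρ : ℝ} (h : Irrational ρ) (h01 : ρ ∈ Ioo (0 : ℝ) 1) (n : ℕ) :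
    ∃ P P' Q Q' : ℝ, 1 ≤ Q ∧ 0 ≤ Q' ∧ Q' ≤ Q ∧ n + 1 ≤ Q + Q' ∧ |P' * Q - P * Q'| = 1 ∧
      ρ = (P + P' * gauss^[n] ρ) / (Q + Q' * gauss^[n] ρ) ∧
      ∀ s ∈ Ioo (0 : ℝ) 1, gauss^[n] ((P + P' * s) / (Q + Q' * s)) = s := by
  induction n with
  | zero => exact ⟨0, 1, 1, 0, by simp⟩
  | succ n ih =>
    obtain ⟨P, P', Q, Q', hQ, hQ', hQQ, hn, hdet, hρ, hs⟩ := ih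
    have ha : (1 : ℝ) ≤ partialQuotient ρ n := by
      exact_mod_cast one_le_partialQuotient h h01 n
    have hinv := one_div_gauss_iterate h h01 n
    have hpos := gauss_iterate_pos h h01 (n + 1)
    set a := partialQuotient ρ n
    have key : ∀ s : ℝ, 0 < s → (a * P + P' + P * s) / (a * Q + Q' + Q * s) =
        (P + P' * (1 / (a + s))) / (Q + Q' * (1 / (a + s))) := by
      intro s hs
      have h1 : 0 < a + s := by linarith
      have h2 : a * Q + Q' + Q * s = (Q + Q' * (1 / (a + s))) * (a + s) := by
        field_simp
        ring
      have h3 : a * P + P' + P * s = (P + P' * (1 / (a + s))) * (a + s) := by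
        field_simp
        ring
      rw [h2, h3, mul_div_mul_right _ _ h1.ne']
    -- Precomposition with s ↦ 1/(a + s). Growth of Q + Q' will make cylinders shrink, and Q' ≤ Q
    -- will bound the distortion.
    refine ⟨a * P + P', P, a * Q + Q', Q, by nlinarith, by linarith, by nlinarith, ?_, ?_, ?_, ?_⟩
    · push_cast
      nlinarith
    · rw [← hdet, ← abs_neg]
      congr 1
      ring
    · rw [key _ hpos, ← hinv, one_div_one_div]
      exact hρ
    · intro s hs'
      have h1 : 1 < a + s := by linarith [hs'.1]
      rw [key s hs'.1, Function.iterate_succ_apply', hs _ ⟨by positivity, (div_lt_one (by linarith)).2 h1⟩,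
        gauss_one_div_add hs']

/-- Every small cylinder contains a definite proportion of points that `Gⁿ` maps into `[c, d]`. -/
theorem exists_cylinder {ρ : ℝ} (h : Irrational ρ) (h01 : ρ ∈ Ioo (0 : ℝ) 1) {c d : ℝ}
    (hc : 0 < c) (hcd : c < d) (hd : d < 1) (n : ℕ) :
    ∃ w r : ℝ, 0 < r ∧ r ≤ 1 / (n + 1) ∧ ρ ∈ Metric.closedBall w r ∧
      ∃ u v : ℝ, Icc u v ⊆ Metric.closedBall w r ∧ (d - c) / 2 * (2 * r) ≤ v - u ∧
        ∀ t ∈ Icc u v, gauss^[n] t ∈ Icc c d := by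
  obtain ⟨P, P', Q, Q', hQ, hQ', hQQ, hn, hdet, hρ, hs⟩ := exists_inverse_branch h h01 n
  set φ : ℝ → ℝ := fun s => (P + P' * s) / (Q + Q' * s) with hφ
  have hden : ∀ s, 0 ≤ s → 0 < Q + Q' * s := fun s hs => by positivity
  set D := P' * Q - P * Q' with hD
  have hdiff : ∀ s t, 0 ≤ s → 0 ≤ t → φ t - φ s = D * (t - s) / ((Q + Q' * s) * (Q + Q' * t)) := by
    intro s t hs ht
    have h1 := (hden s hs).ne'
    have h2 := (hden t ht).ne'
    simp only [hφ]
    rw [div_sub_div _ _ h2 h1, div_eq_div_iff (mul_ne_zero h2 h1) (mul_ne_zero h1 h2)]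
    ring
  have hseg : ∀ t ∈ Icc (0 : ℝ) 1, φ t ∈ uIcc (φ 0) (φ 1) := by
    intro t ht
    -- The witness below is the barycentric coordinate of φ t between φ 0 and φ 1.
    rw [← segment_eq_uIcc, segment_eq_image']
    refine ⟨t * (Q + Q') / (Q + Q' * t), ⟨?_, ?_⟩, ?_⟩
    · have := hden t ht.1
      have := ht.1
      positivity
    · rw [div_le_one (hden t ht.1)]
      nlinarith [ht.1, ht.2]
    · have h1 := hdiff 0 t le_rfl ht.1
      have h2 := hdiff 0 1 le_rfl zero_le_one
      have h3 := (hden t ht.1).ne'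
      have h4 : Q + Q' ≠ 0 := by positivity
      rw [← sub_eq_zero]
      simp only [smul_eq_mul]
      rw [h2]
      have : φ t = φ 0 + (φ t - φ 0) := by ring
      rw [this, h1]
      field_simp
      ring
  have hcont : ContinuousOn φ (uIcc c d) := by
    refine ContinuousOn.div (by fun_prop) (by fun_prop) fun s hs => ?_
    rw [uIcc_of_le hcd.le] at hs
    exact (hden s (hc.le.trans hs.1)).ne'
  have hw : uIcc (φ 0) (φ 1) =
      Metric.closedBall ((φ 0 + φ 1) / 2) (|φ 1 - φ 0| / 2) := by
    rw [uIcc, Real.Icc_eq_closedBall, ← max_sub_min_eq_abs, min_add_max]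
  have hlen : |φ 1 - φ 0| = 1 / (Q * (Q + Q')) := by
    rw [hdiff 0 1 le_rfl zero_le_one, abs_div, abs_mul, hdet, abs_of_pos (by positivity : 0 < (Q + Q' * 0) * (Q + Q' * 1))]
    simp
  have hlen' : |φ d - φ c| = (d - c) / ((Q + Q' * c) * (Q + Q' * d)) := by
    have h1 := hden c hc.le
    have h2 := hden d (hc.trans hcd).le
    rw [hdiff c d hc.le (hc.trans hcd).le, abs_div, abs_mul, hdet, abs_of_pos (mul_pos h1 h2),
      one_mul, abs_of_pos (sub_pos.2 hcd)]
  refine ⟨(φ 0 + φ 1) / 2, |φ 1 - φ 0| / 2, ?_, ?_, ?_, min (φ c) (φ d), max (φ c) (φ d), ?_, ?_, ?_⟩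
  · rw [hlen]; positivity
  · rw [hlen, div_div, div_le_div_iff₀ (by positivity) (by positivity)]
    nlinarith
  · rw [← hw, hρ]
    exact hseg _ (Ioo_subset_Icc_self (gauss_iterate_mem_Ioo h h01 n))
  · rw [← hw]
    exact uIcc_subset_uIcc (hseg c ⟨hc.le, by linarith⟩) (hseg d ⟨by linarith, hd.le⟩)
  · rw [max_sub_min_eq_abs, hlen, hlen']
    have h1 := hden c hc.le
    have h2 := hden d (hc.trans hcd).le
    -- Bounded distortion: since Q' ≤ Q, passing from [0, 1] to [c, d] loses at most a factor 2
    -- against the ratio of lengths d − c.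
    have h3 : Q + Q' * c ≤ Q + Q' := by nlinarith
    have h4 : Q + Q' * d ≤ 2 * Q := by nlinarith
    have h5 : (Q + Q' * c) * (Q + Q' * d) ≤ (Q + Q') * (2 * Q) :=
      mul_le_mul h3 h4 h2.le (by positivity)
    calc (d - c) / 2 * (2 * (1 / (Q * (Q + Q')) / 2)) = (d - c) / ((Q + Q') * (2 * Q)) := by
          field_simp
      _ ≤ _ := div_le_div_of_nonneg_left (by linarith) (mul_pos h1 h2) h5
  · intro t ht
    obtain ⟨s, hs', rfl⟩ := intermediate_value_uIcc hcont ht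
    rw [uIcc_of_le hcd.le] at hs'
    simp only [hφ]
    rwa [hs s ⟨by linarith [hs'.1], by linarith [hs'.2]⟩]

/-- At a density point of the avoiding set, the cylinders shrinking to it would be filled in
proportion tending to 1, yet each loses a fraction at least (d − c)/2. Neither the Gauss measure nor
its ergodicity is needed. -/
theorem ae_exists_gauss_iterate_mem {c d : ℝ} (hc : 0 < c) (hcd : c < d) (hd : d < 1) :
    volume {ρ : ℝ | (Irrational ρ ∧ ρ ∈ Ioo (0 : ℝ) 1) ∧ ∀ n, gauss^[n] ρ ∉ Icc c d} = 0 := by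
  set E := {ρ : ℝ | (Irrational ρ ∧ ρ ∈ Ioo (0 : ℝ) 1) ∧ ∀ n, gauss^[n] ρ ∉ Icc c d} with hE
  by_contra hne
  -- The balls only have to contain x: cylinders are not centred at it.
  have hex : ∃ x ∈ E, ∀ w r : ℕ → ℝ, Tendsto r atTop (𝓝[>] 0) →
      (∀ᶠ n in atTop, x ∈ Metric.closedBall (w n) (1 * r n)) →
      Tendsto (fun n => volume (E ∩ Metric.closedBall (w n) (r n)) /
        volume (Metric.closedBall (w n) (r n))) atTop (𝓝 1) := by
    by_contra! hno
    refine hne ?_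
    rw [← Measure.restrict_apply_self]
    have hdens := ae_iff.1
      (IsUnifLocDoublingMeasure.ae_tendsto_measure_inter_div.{0, 0} (volume : Measure ℝ) E 1)
    refine measure_mono_null (fun x hx => ?_) hdens
    rw [mem_ofPred_eq]
    intro hP
    obtain ⟨w, r, hr, hw, hnot⟩ := hno x hx
    exact hnot (hP w r hr hw)
  obtain ⟨x, hxE, hx⟩ := hex
  choose w r hr hrn hmem u v hsub hlen hhit using
    fun n => exists_cylinder hxE.1.1 hxE.1.2 hc hcd hd n
  have hlim := hx w r
    (tendsto_nhdsWithin_iff.2 ⟨squeeze_zero (fun n => (hr n).le) hrn tendsto_one_div_add_atTop_nhds_zero_nat,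
      Eventually.of_forall hr⟩) (Eventually.of_forall fun n => by rw [one_mul]; exact hmem n)
  have hbound : ∀ n, volume (E ∩ Metric.closedBall (w n) (r n)) /
      volume (Metric.closedBall (w n) (r n)) ≤ ENNReal.ofReal (1 - (d - c) / 2) := by
    intro n
    have h2r : 0 < 2 * r n := by linarith [hr n]
    rw [Real.volume_closedBall, ENNReal.div_le_iff (by simpa using h2r) ENNReal.ofReal_ne_top,
      ← ENNReal.ofReal_mul (by linarith)]
    calc volume (E ∩ Metric.closedBall (w n) (r n))
        ≤ volume (Metric.closedBall (w n) (r n) \ Icc (u n) (v n)) :=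
          measure_mono fun t ht => ⟨ht.2, fun htt => ht.1.2 n (hhit n t htt)⟩
      _ = ENNReal.ofReal (2 * r n) - ENNReal.ofReal (v n - u n) := by
          rw [measure_sdiff (hsub n) measurableSet_Icc.nullMeasurableSet (by simp),
            Real.volume_closedBall, Real.volume_Icc]
      _ ≤ _ := by
          rw [← ENNReal.ofReal_sub _ (by nlinarith [hlen n])]
          exact ENNReal.ofReal_le_ofReal (by nlinarith [hlen n])
  have := le_of_tendsto' hlim hbound
  rw [← ENNReal.ofReal_one, ENNReal.ofReal_le_ofReal_iff (by linarith)] at this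
  linarith

theorem volume_diff_gaussGeneric : volume (Icc (0 : ℝ) 1 \ gaussGeneric) = 0 := by
  have hsub : Icc (0 : ℝ) 1 \ gaussGeneric ⊆ {ρ : ℝ | Irrational ρ}ᶜ ∪ {0} ∪ {1} ∪
      ⋃ (c : ℚ) (d : ℚ) (_ : 0 < c ∧ c < d ∧ d < 1),
        {ρ : ℝ | (Irrational ρ ∧ ρ ∈ Ioo (0 : ℝ) 1) ∧ ∀ n, gauss^[n] ρ ∉ Icc (c : ℝ) d} := by
    rintro ρ ⟨hρ, hn⟩
    by_cases hirr : Irrational ρ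
    · right
      have h01 : ρ ∈ Ioo (0 : ℝ) 1 :=
        ⟨lt_of_le_of_ne hρ.1 hirr.ne_zero.symm, lt_of_le_of_ne hρ.2 hirr.ne_one⟩
      by_contra hno
      refine hn ⟨hirr, h01, fun c d hc hcd hd => ?_⟩
      by_contra! hnn
      exact hno (mem_iUnion₂.2 ⟨c, d, mem_iUnion.2 ⟨⟨hc, hcd, hd⟩, ⟨hirr, h01⟩, hnn⟩⟩)
    · exact Or.inl (Or.inl (Or.inl hirr))
  refine measure_mono_null hsub ?_
  have hcount : ({ρ : ℝ | Irrational ρ}ᶜ).Countable := by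
    have : {ρ : ℝ | Irrational ρ}ᶜ = range ((↑) : ℚ → ℝ) := by
      ext; simp [Irrational]
    rw [this]
    exact countable_range _
  simp only [measure_union_null_iff, measure_iUnion_null_iff]
  refine ⟨⟨⟨hcount.measure_zero _, by simp⟩, by simp⟩, fun c d hcd => ?_⟩
  exact ae_exists_gauss_iterate_mem (by exact_mod_cast hcd.1) (by exact_mod_cast hcd.2.1)
    (by exact_mod_cast hcd.2.2)

/-- A generic Gauss orbit visits every interval infinitely often. -/
theorem frequently_gauss_iterate_mem {ρ : ℝ} (hρ : ρ ∈ gaussGeneric) {c d : ℝ} (hc : 0 ≤ c)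
    (hcd : c < d) (hd : d ≤ 1) : ∃ᶠ n in atTop, gauss^[n] ρ ∈ Ioo c d := by
  rw [frequently_atTop]
  intro N
  -- A visit to a subinterval free of the first N orbit points must occur at a time at least N.
  set S : Finset ℝ := (Finset.range N).image fun n => gauss^[n] ρ with hS
  have hinf : (Ioo c d \ S).Nonempty := ((Ioo_infinite hcd).sdiff S.finite_toSet).nonempty
  have hopen : IsOpen (Ioo c d \ (S : Set ℝ)) := isOpen_Ioo.sdiff S.finite_toSet.isClosed
  obtain ⟨x, hx⟩ := hinf
  obtain ⟨l, u, hxlu, hlu⟩ := (mem_nhds_iff_exists_Ioo_subset.1 (hopen.mem_nhds hx))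
  obtain ⟨p, hp1, hp2⟩ := exists_rat_btwn hxlu.2
  obtain ⟨q, hq1, hq2⟩ := exists_rat_btwn hp2
  have hsub : ∀ t ∈ Icc (p : ℝ) q, t ∈ Ioo c d \ (S : Set ℝ) := fun t ht =>
    hlu ⟨by linarith [hxlu.1, ht.1], by linarith [ht.2]⟩
  have hp := hsub p ⟨le_rfl, hq1.le⟩
  have hq := hsub q ⟨hq1.le, le_rfl⟩
  obtain ⟨n, hn⟩ := hρ.2.2 p q (by exact_mod_cast hc.trans_lt hp.1.1) (by exact_mod_cast hq1)
    (by exact_mod_cast hq.1.2.trans_le hd)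
  have hn' := hsub _ hn
  refine ⟨n, ?_, hn'.1⟩
  by_contra! hlt
  exact hn'.2 (by simpa [hS] using ⟨n, hlt, rfl⟩)

/-! ### Towers of intervals over the rotation -/

/-- The `i`-th translate of the arc `{θ s : e < θ < g}` under the rotation by `ρ`. -/
def storey (ρ : ℝ) (i : ℕ) (s e g : ℝ) : Set S1 :=
  (fun t : ℝ => (t : S1)) '' ((fun θ : ℝ => i * ρ + θ * s) '' Ioo e g)

/-- The union of the first `q` translates of the arc `{θ s : e < θ < g}`. -/
def tower (ρ : ℝ) (q : ℕ) (s e g : ℝ) : Set S1 := ⋃ i ∈ Finset.range q, storey ρ i s e g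

theorem mem_storey {ρ : ℝ} {i : ℕ} {s e g : ℝ} {y : S1} :
    y ∈ storey ρ i s e g ↔ ∃ θ ∈ Ioo e g, ((i * ρ + θ * s : ℝ) : S1) = y := by
  simp only [storey, mem_image, exists_exists_and_eq_and]

theorem mem_tower {ρ : ℝ} {q : ℕ} {s e g : ℝ} {y : S1} :
    y ∈ tower ρ q s e g ↔ ∃ i < q, ∃ θ ∈ Ioo e g, ((i * ρ + θ * s : ℝ) : S1) = y := by
  simp only [tower, mem_iUnion, Finset.mem_range, mem_storey, exists_prop]

theorem exists_storey_eq (ρ : ℝ) (i : ℕ) {s e g : ℝ} (hs : s ≠ 0) :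
    ∃ a b : ℝ, b - a = |s| * (g - e) ∧ storey ρ i s e g = (fun t : ℝ => (t : S1)) '' Ioo a b := by
  rcases lt_or_gt_of_ne hs with hneg | hpos
  · refine ⟨i * ρ + g * s, i * ρ + e * s, by rw [abs_of_neg hneg]; ring, ?_⟩
    rw [storey]
    congr 1
    ext t
    constructor
    · rintro ⟨θ, hθ, rfl⟩
      exact ⟨by nlinarith [hθ.2], by nlinarith [hθ.1]⟩
    · intro ht
      refine ⟨(t - i * ρ) / s, ⟨?_, ?_⟩, by simp only; field_simp; ring⟩
      · rw [lt_div_iff_of_neg hneg]; linarith [ht.2]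
      · rw [div_lt_iff_of_neg hneg]; linarith [ht.1]
  · refine ⟨i * ρ + e * s, i * ρ + g * s, by rw [abs_of_pos hpos]; ring, ?_⟩
    rw [storey]
    congr 1
    ext t
    constructor
    · rintro ⟨θ, hθ, rfl⟩
      exact ⟨by nlinarith [hθ.1], by nlinarith [hθ.2]⟩
    · intro ht
      refine ⟨(t - i * ρ) / s, ⟨?_, ?_⟩, by simp only; field_simp; ring⟩
      · rw [lt_div_iff₀ hpos]; linarith [ht.1]
      · rw [div_lt_iff₀ hpos]; linarith [ht.2]

theorem isOpen_storey (ρ : ℝ) (i : ℕ) {s e g : ℝ} (hs : s ≠ 0) : IsOpen (storey ρ i s e g) := by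
  obtain ⟨a, b, -, h⟩ := exists_storey_eq ρ i (e := e) (g := g) hs
  rw [h]
  exact isOpenMap_coe _ isOpen_Ioo

theorem isOpen_tower (ρ : ℝ) (q : ℕ) {s e g : ℝ} (hs : s ≠ 0) : IsOpen (tower ρ q s e g) :=
  isOpen_biUnion fun _ _ => isOpen_storey ρ _ hs

theorem volume_storey (ρ : ℝ) (i : ℕ) {s e g : ℝ} (hs : s ≠ 0) (hle : |s| * (g - e) ≤ 1) :
    volume (storey ρ i s e g) = ENNReal.ofReal (|s| * (g - e)) := by
  obtain ⟨a, b, hab, h⟩ := exists_storey_eq ρ i (e := e) (g := g) hs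
  rw [h, volume_image_Ioo (by linarith), hab]

theorem volume_tower {ρ : ℝ} (h : Irrational ρ) (h01 : ρ ∈ Ioo (0 : ℝ) 1) {n q : ℕ} {s e g : ℝ}
    (hq : q ≤ returnTime ρ (n + 1)) (hs0 : s ≠ 0) (hs : |s| ≤ gap ρ n) (he : 0 ≤ e) (heg : e ≤ g)
    (hg : g ≤ 1) : volume (tower ρ q s e g) = ENNReal.ofReal (q * (|s| * (g - e))) := by
  have hle : |s| * (g - e) ≤ 1 := by
    nlinarith [abs_nonneg s, hs.trans (gap_lt_one h h01 n).le]
  rw [tower, measure_biUnion_finset ?_ fun i _ => (isOpen_storey ρ i hs0).measurableSet]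
  · simp only [volume_storey ρ _ hs0 hle, Finset.sum_const, Finset.card_range, nsmul_eq_mul]
    rw [ENNReal.ofReal_mul (p := (q : ℝ)) (by positivity), ENNReal.ofReal_natCast]
  · intro i hi j hj hij
    refine Set.disjoint_left.2 fun y hy hy' => hij ?_
    obtain ⟨θ, hθ, rfl⟩ := mem_storey.1 hy
    obtain ⟨θ', hθ', heq⟩ := mem_storey.1 hy'
    exact (tower_position_unique h h01 ((Finset.mem_range.1 hi).trans_le hq)
      ((Finset.mem_range.1 hj).trans_le hq) hs0 hs ⟨he.trans_lt hθ.1, hθ.2.trans_le hg⟩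
      ⟨(he.trans_lt hθ'.1).le, (hθ'.2.trans_le hg).le⟩ heq.symm).1

theorem ergodic_rotation {ρ : ℝ} (h : Irrational ρ) :
    Ergodic (fun y : S1 => (ρ : S1) + y) volume := by
  refine AddCircle.ergodic_add_left.2 (addOrderOf_eq_zero_iff'.2 fun n hn h0 => ?_)
  rw [← AddCircle.coe_nsmul, AddCircle.coe_eq_zero_iff] at h0
  obtain ⟨m, hm⟩ := h0
  rw [zsmul_one, nsmul_eq_mul] at hm
  exact (h.natCast_mul hn.ne').ne_int m hm.symm

/-- A sequence of towers of summable width whose measure is bounded below infinitely often covers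
almost every point infinitely often. -/
theorem volume_compl_exists_mem_tower {ρ : ℝ} (h : Irrational ρ) {q : ℕ → ℕ} {s : ℕ → ℝ}
    {e g : ℝ} (hs0 : ∀ n, s n ≠ 0) (hle : ∀ n, |s n| * (g - e) ≤ 1) (hsum : Summable fun n => |s n|)
    {p : ℕ → Prop} (hp : ∃ᶠ n in atTop, p n) {κ : ℝ} (hκ : 0 < κ)
    (hκn : ∀ n, p n → ENNReal.ofReal κ ≤ volume (tower ρ (q n) (s n) e g)) :
    volume {y : S1 | ∃ n, p n ∧ y ∈ tower ρ (q n) (s n) e g}ᶜ = 0 := by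
  set U : ℕ → Set S1 := fun N => ⋃ n, ⋃ (_ : N ≤ n ∧ p n), tower ρ (q n) (s n) e g with hU
  have hUo : ∀ N, IsOpen (U N) := fun N =>
    isOpen_iUnion fun n => isOpen_iUnion fun _ => isOpen_tower ρ _ (hs0 n)
  have hUmem : ∀ N y, y ∈ U N ↔ ∃ n, (N ≤ n ∧ p n) ∧ y ∈ tower ρ (q n) (s n) e g := by
    intro N y
    simp only [hU, mem_iUnion, exists_prop]
  set L : Set S1 := ⋂ N, U N with hL
  have hLm : MeasurableSet L := MeasurableSet.iInter fun N => (hUo N).measurableSet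
  have hpos : ENNReal.ofReal κ ≤ volume L := by
    refine ge_of_tendsto' (tendsto_measure_iInter_atTop (μ := (volume : Measure S1))
      (fun N => (hUo N).measurableSet.nullMeasurableSet) ?_ ⟨0, measure_ne_top _ _⟩) fun N => ?_
    · intro M N hMN y hy
      obtain ⟨n, hn, hy⟩ := (hUmem _ _).1 hy
      exact (hUmem _ _).2 ⟨n, ⟨hMN.trans hn.1, hn.2⟩, hy⟩
    · obtain ⟨n, hn, hpn⟩ := frequently_atTop.1 hp N
      exact (hκn n hpn).trans (measure_mono fun y hy => (hUmem _ _).2 ⟨n, ⟨hn, hpn⟩, hy⟩)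
  -- Only a point in the top storey can leave the tower under the rotation, and almost every point
  -- is in finitely many top storeys.
  have hBC : ∀ᵐ y : S1, ∀ᶠ n in atTop, y ∉ storey ρ (q n - 1) (s n) e g := by
    refine ae_eventually_notMem ?_
    simp only [fun n => volume_storey ρ (q n - 1) (hs0 n) (hle n)]
    exact (hsum.mul_right (g - e)).tsum_ofReal_ne_top
  have hinv : L ≤ᵐ[volume] (fun y : S1 => (ρ : S1) + y) ⁻¹' L := by
    filter_upwards [hBC] with y hy hyL
    obtain ⟨N₀, hN₀⟩ := eventually_atTop.1 hy
    refine mem_iInter.2 fun N => (hUmem _ _).2 ?_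
    obtain ⟨n, ⟨hn, hpn⟩, hyn⟩ := (hUmem _ _).1 (mem_iInter.1 hyL (max N N₀))
    refine ⟨n, ⟨(le_max_left _ _).trans hn, hpn⟩, ?_⟩
    obtain ⟨i, hi, θ, hθ, hy⟩ := mem_tower.1 hyn
    have hne : i ≠ q n - 1 := by
      rintro rfl
      exact hN₀ n ((le_max_right _ _).trans hn) (mem_storey.2 ⟨θ, hθ, hy⟩)
    refine mem_tower.2 ⟨i + 1, by omega, θ, hθ, ?_⟩
    change _ = (ρ : S1) + y
    rw [← hy, ← AddCircle.coe_add]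
    congr 1
    push_cast
    ring
  have hLc : volume Lᶜ = 0 := by
    rcases (ergodic_rotation h).ae_empty_or_univ_of_ae_le_preimage hLm.nullMeasurableSet hinv
      with h0 | h1
    · rw [ae_eq_empty.1 h0] at hpos
      exact absurd hpos (by simpa using hκ)
    · exact ae_eq_univ.1 h1
  refine measure_mono_null (compl_subset_compl.2 fun y hy => ?_) hLc
  obtain ⟨n, hn, hy⟩ := (hUmem _ _).1 (mem_iInter.1 hy 0)
  exact ⟨n, hn.2, hy⟩

theorem abs_signedGap {ρ : ℝ} (h : Irrational ρ) (h01 : ρ ∈ Ioo (0 : ℝ) 1) (n : ℕ) :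
    |signedGap ρ n| = gap ρ n := by
  rw [signedGap, abs_mul, abs_pow, abs_neg, abs_one, one_pow, one_mul, abs_of_pos (gap_pos h h01 n)]

theorem signedGap_ne_zero {ρ : ℝ} (h : Irrational ρ) (h01 : ρ ∈ Ioo (0 : ℝ) 1) (n : ℕ) :
    signedGap ρ n ≠ 0 := by
  rw [← abs_pos, abs_signedGap h h01]
  exact gap_pos h h01 n

theorem volume_compl_exists_mem_longTower {ρ : ℝ} (hρ : ρ ∈ gaussGeneric) {c d e g : ℝ}
    (hc : 0 < c) (hcd : c < d) (hd : d ≤ 1) (he : 0 ≤ e) (heg : e < g) (hg : g ≤ 1) :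
    volume {y : S1 | ∃ n, gauss^[n + 1] ρ ∈ Ioo c d ∧
      y ∈ tower ρ (returnTime ρ (n + 1)) (signedGap ρ n) e g}ᶜ = 0 := by
  obtain ⟨h, h01, -⟩ := id hρ
  refine volume_compl_exists_mem_tower h (κ := 1 / 2 * (g - e)) (signedGap_ne_zero h h01) ?_ ?_ ?_
    (mul_pos one_half_pos (sub_pos.2 heg)) ?_
  · intro n
    rw [abs_signedGap h h01]
    nlinarith [gap_pos h h01 n, gap_lt_one h h01 n]
  · simpa only [abs_signedGap h h01] using summable_gap h h01
  · have := frequently_gauss_iterate_mem hρ hc.le hcd hd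
    rw [frequently_atTop] at this ⊢
    intro N
    obtain ⟨n, hn, hmem⟩ := this (N + 1)
    obtain ⟨m, rfl⟩ := Nat.exists_eq_add_of_le' (Nat.one_le_of_lt hn)
    exact ⟨m, by omega, hmem⟩
  · intro n _
    rw [volume_tower h h01 le_rfl (signedGap_ne_zero h h01 n) (abs_signedGap h h01 n).le he heg.le hg,
      abs_signedGap h h01, ← mul_assoc]
    exact ENNReal.ofReal_le_ofReal (mul_le_mul_of_nonneg_right
      (half_le_returnTime_mul_gap h h01 n) (sub_pos.2 heg).le)

/-- The branch of the Gauss map with partial quotient 1. It lets a condition on Gⁿ(ρ) keep both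
Gⁿ(ρ) and Gⁿ⁺¹(ρ) away from 0, as the short towers require. -/
theorem gauss_mem_Ioo_of_mem {c d x : ℝ} (hc : 0 < c) (hd : d ≤ 1)
    (hx : x ∈ Ioo (1 / (1 + d)) (1 / (1 + c))) (hd0 : 0 < d) : gauss x ∈ Ioo c d := by
  have hx0 : 0 < x := lt_trans (by positivity) hx.1
  have h1 : 1 / x < 1 + d := by
    rw [div_lt_comm₀ hx0 (by positivity)]
    exact hx.1
  have h2 : 1 + c < 1 / x := by
    rw [lt_div_comm₀ (by positivity) hx0]
    exact hx.2
  have h3 : gauss x = 1 / x - 1 :=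
    Int.fract_eq_iff.2 ⟨by linarith, by linarith, 1, by push_cast; ring⟩
  rw [h3]
  exact ⟨by linarith, by linarith⟩

theorem volume_compl_exists_mem_shortTower {ρ : ℝ} (hρ : ρ ∈ gaussGeneric) {c d e g : ℝ}
    (hc : 0 < c) (hcd : c < d) (hd : d ≤ 1) (he : 0 ≤ e) (heg : e < g) (hg : g ≤ 1) :
    volume {y : S1 | ∃ n, gauss^[n + 1] ρ ∈ Ioo c d ∧
      y ∈ tower ρ (returnTime ρ n) (signedGap ρ (n + 1)) e g}ᶜ = 0 := by
  obtain ⟨h, h01, -⟩ := id hρ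
  have hd0 : 0 < d := hc.trans hcd
  have hmain := volume_compl_exists_mem_tower h (q := returnTime ρ) (e := e) (g := g)
    -- κ combines Gⁿ(ρ) > 1/(1 + d) and Gⁿ⁺¹(ρ) > c in `le_returnTime_mul_gap_succ`.
    (s := fun n => signedGap ρ (n + 1)) (κ := 1 / (1 + d) * c / 4 * (g - e))
    (p := fun n => gauss^[n] ρ ∈ Ioo (1 / (1 + d)) (1 / (1 + c)))
    (fun n => signedGap_ne_zero h h01 _) ?_ ?_ ?_
    (mul_pos (by positivity) (sub_pos.2 heg)) ?_
  · refine measure_mono_null (compl_subset_compl.2 ?_) hmain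
    rintro y ⟨n, hn, hy⟩
    refine ⟨n, ?_, hy⟩
    rw [Function.iterate_succ_apply']
    exact gauss_mem_Ioo_of_mem hc hd hn hd0
  · intro n
    rw [abs_signedGap h h01]
    nlinarith [gap_pos h h01 (n + 1), gap_lt_one h h01 (n + 1)]
  · simpa only [abs_signedGap h h01] using (summable_nat_add_iff 1).2 (summable_gap h h01)
  · exact frequently_gauss_iterate_mem hρ (by positivity)
      (one_div_lt_one_div_of_lt (by positivity) (by linarith))
      ((div_le_one (by positivity)).2 (by linarith))
  · intro n hn
    have hmem : gauss^[n + 1] ρ ∈ Ioo c d := by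
      rw [Function.iterate_succ_apply']
      exact gauss_mem_Ioo_of_mem hc hd hn hd0
    rw [volume_tower h h01 (returnTime_le_succ h h01 n) (signedGap_ne_zero h h01 (n + 1))
      ((abs_signedGap h h01 (n + 1)).le.trans (gap_succ_lt h h01 n).le) he heg.le hg,
      abs_signedGap h h01, ← mul_assoc]
    refine ENNReal.ofReal_le_ofReal (mul_le_mul_of_nonneg_right
      (le_trans ?_ (le_returnTime_mul_gap_succ h h01 n)) (sub_pos.2 heg).le)
    have := mul_le_mul hn.1.le hmem.1.le hc.le (gauss_iterate_pos h h01 n).le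
    linarith

/-- Disjoint open towers of total length one miss only a null set; this replaces the exact partition
of the circle. -/
theorem volume_compl_towers {ρ : ℝ} (h : Irrational ρ) (h01 : ρ ∈ Ioo (0 : ℝ) 1) (n : ℕ) :
    volume (tower ρ (returnTime ρ (n + 1)) (signedGap ρ n) 0 1 ∪
      tower ρ (returnTime ρ n) (signedGap ρ (n + 1)) 0 1)ᶜ = 0 := by
  have hs := signedGap_ne_zero h h01
  have hprob : IsProbabilityMeasure (volume : Measure S1) := ⟨UnitAddCircle.measure_univ⟩
  have hd : Disjoint (tower ρ (returnTime ρ (n + 1)) (signedGap ρ n) 0 1)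
      (tower ρ (returnTime ρ n) (signedGap ρ (n + 1)) 0 1) := by
    refine Set.disjoint_left.2 fun y hy hy' => ?_
    obtain ⟨i, hi, θ, hθ, rfl⟩ := mem_tower.1 hy
    obtain ⟨j, hj, θ', hθ', heq⟩ := mem_tower.1 hy'
    have h1 := gap_pos h h01 n
    have h2 := gap_pos h h01 (n + 1)
    exact tower_position_disjoint h h01 hi hj
      (add_pos (mul_pos hθ.1 h1) (mul_pos hθ'.1 h2))
      (add_lt_add (mul_lt_of_lt_one_left h1 hθ.2) (mul_lt_of_lt_one_left h2 hθ'.2)) heq.symm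
  have hm := fun q m => (isOpen_tower ρ q (e := 0) (g := 1) (hs m)).measurableSet
  rw [prob_compl_eq_zero_iff ((hm _ _).union (hm _ _)), measure_union hd (hm _ _),
    volume_tower h h01 le_rfl (hs n) (abs_signedGap h h01 n).le le_rfl zero_le_one le_rfl,
    volume_tower h h01 (returnTime_le_succ h h01 n) (hs (n + 1))
      ((abs_signedGap h h01 (n + 1)).le.trans (gap_succ_lt h h01 n).le) le_rfl zero_le_one le_rfl,
    ← ENNReal.ofReal_add (by simp; positivity) (by simp; positivity),
    abs_signedGap h h01, abs_signedGap h h01, sub_zero, mul_one, mul_one,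
    returnTime_mul_gap_add h h01, ENNReal.ofReal_one]

/-! ### Trails in the coordinates of the rotation -/

/-- `h` conjugates `f` to its rotation, maps `x` to the origin and `μ` to Lebesgue measure, and
preserves the cyclic order. -/
structure IsRotationChart (f : S1 ≃ₜ S1) (μ : Measure S1) (x : S1) (h : S1 ≃ₜ S1) : Prop where
  conj : ∀ y, h (f y) = h y + (rotationNumber f : S1)
  base : h x = 0
  mem_cIoo : ∀ a b c, c ∈ Set.cIoo a b ↔ h c ∈ Set.cIoo (h a) (h b)
  measure : ∀ S : Set S1, μ (h ⁻¹' S) = volume S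

namespace IsRotationChart

variable {f : S1 ≃ₜ S1} {μ : Measure S1} {x : S1} {h : S1 ≃ₜ S1} (C : IsRotationChart f μ x h)
include C

theorem conj_iterate (i : ℕ) (y : S1) : h (f^[i] y) = h y + ((i * rotationNumber f : ℝ) : S1) := by
  induction i with
  | zero => simp
  | succ i ih =>
    rw [Function.iterate_succ_apply', C.conj, ih, add_assoc, ← AddCircle.coe_add]
    congr 2
    push_cast
    ring

theorem cIoo_eq (a b : S1) : Set.cIoo a b = h ⁻¹' Set.cIoo (h a) (h b) :=
  Set.ext fun c => C.mem_cIoo a b c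

theorem arcIoc_eq (a b : S1) : arcIoc a b = h ⁻¹' arcIoc (h a) (h b) := by
  ext c
  simp only [arcIoc, mem_insert_iff, mem_preimage, C.mem_cIoo a b c, h.injective.eq_iff]

theorem measureReal (S : Set S1) : μ.real (h ⁻¹' S) = volume.real S := by
  rw [Measure.real, Measure.real, C.measure]

variable (hirr : Irrational (rotationNumber f)) (h01 : rotationNumber f ∈ Ioo (0 : ℝ) 1)
include hirr h01

theorem iterate_returnTime (n : ℕ) :
    h (f^[returnTime (rotationNumber f) n] x) = (signedGap (rotationNumber f) n : S1) := by
  rw [C.conj_iterate, C.base, zero_add, coe_eq_coe_iff]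
  exact ⟨winding (rotationNumber f) n, by rw [signedGap_eq hirr h01]; ring⟩

-- The point at time qₙ₊₂ lies on the same side of the origin as the one at time qₙ, and closer;
-- this selects the short arc as Iₙ.
omit C in
theorem exists_signedGap_add_two (n : ℕ) : ∃ r ∈ Ioo (0 : ℝ) 1,
    signedGap (rotationNumber f) (n + 2) = r * signedGap (rotationNumber f) n := by
  have h1 := gauss_iterate_mem_Ioo hirr h01 (n + 1)
  have h2 := gauss_iterate_mem_Ioo hirr h01 (n + 2)
  refine ⟨_, ⟨mul_pos h1.1 h2.1, mul_lt_one_of_nonneg_of_lt_one_left h1.1.le h1.2 h2.2.le⟩, ?_⟩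
  simp only [signedGap, gap]
  ring

theorem dynInterval_of_pos {n : ℕ} (hs : 0 < signedGap (rotationNumber f) n) :
    dynInterval f x n =
      h ⁻¹' ((fun t : ℝ => (t : S1)) '' Ioc 0 (signedGap (rotationNumber f) n)) := by
  set s := signedGap (rotationNumber f) n with hsdef
  have hs1 : s < 1 := by
    rw [← abs_of_pos hs, abs_signedGap hirr h01]
    exact gap_lt_one hirr h01 n
  have harc : arcIoc x (f^[returnTime (rotationNumber f) n] x) =
      h ⁻¹' ((fun t : ℝ => (t : S1)) '' Ioc 0 s) := by
    rw [C.arcIoc_eq, C.iterate_returnTime hirr h01, C.base, ← arcIoc_coe hs (by linarith)]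
    rfl
  refine (if_pos ?_).trans harc
  obtain ⟨r, hr, hrs⟩ := exists_signedGap_add_two hirr h01 n
  rw [harc, mem_preimage, C.iterate_returnTime hirr h01]
  exact ⟨_, ⟨by rw [hrs]; exact mul_pos hr.1 hs, by
    rw [hrs]; exact (mul_lt_of_lt_one_left hs hr.2).le⟩, rfl⟩

theorem dynInterval_of_neg {n : ℕ} (hs : signedGap (rotationNumber f) n < 0) :
    dynInterval f x n =
      h ⁻¹' ((fun t : ℝ => (t : S1)) '' Ioc (signedGap (rotationNumber f) n) 0) := by
  set s := signedGap (rotationNumber f) n with hsdef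
  have hs1 : -1 < s := by
    have := gap_lt_one hirr h01 n
    rw [← abs_signedGap hirr h01, abs_of_neg hs] at this
    linarith
  -- For negative s the counterclockwise arc from 0 ends at s + 1, and r s + 1 lies beyond it; so
  -- the other arc is Iₙ.
  have hs' : ((s + 1 : ℝ) : S1) = (s : S1) := coe_eq_coe_iff.2 ⟨1, by simp⟩
  have harc : arcIoc x (f^[returnTime (rotationNumber f) n] x) =
      h ⁻¹' ((fun t : ℝ => (t : S1)) '' Ioc 0 (s + 1)) := by
    rw [C.arcIoc_eq, C.iterate_returnTime hirr h01, C.base, ← hsdef, ← hs',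
      ← arcIoc_coe (by linarith) (by linarith)]
    rfl
  have harc' : arcIoc (f^[returnTime (rotationNumber f) n] x) x =
      h ⁻¹' ((fun t : ℝ => (t : S1)) '' Ioc s 0) := by
    rw [C.arcIoc_eq, C.iterate_returnTime hirr h01, C.base, ← arcIoc_coe hs (by linarith)]
    rfl
  refine (if_neg ?_).trans harc'
  obtain ⟨r, hr, hrs⟩ := exists_signedGap_add_two hirr h01 n
  have hlt := mul_lt_of_lt_one_left (neg_pos.2 hs) hr.2
  have hneg := mul_neg_of_pos_of_neg hr.1 hs
  rw [harc, mem_preimage, C.iterate_returnTime hirr h01, hrs]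
  rintro ⟨t, ht, htr⟩
  have hmem : r * s + 1 ∈ Ioc (0 : ℝ) (0 + 1) := ⟨by linarith, by linarith⟩
  have : t = r * s + 1 := coe_injOn_Ioc 0 ⟨ht.1, by linarith [ht.2]⟩ hmem
    (htr.trans (coe_eq_coe_iff.2 ⟨-1, by push_cast; ring⟩))
  linarith [ht.2]

/-- Which endpoint Iₙ contains depends on the parity of n. A closed range of θ here and an open one
in the converse avoid that distinction. -/
theorem exists_of_mem_dynInterval {n : ℕ} {z : S1} (hz : z ∈ dynInterval f x n) :
    ∃ θ ∈ Icc (0 : ℝ) 1, h z = ((θ * signedGap (rotationNumber f) n : ℝ) : S1) := by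
  rcases lt_or_gt_of_ne (signedGap_ne_zero hirr h01 n) with hs | hs
  · rw [C.dynInterval_of_neg hirr h01 hs] at hz
    obtain ⟨t, ht, htz⟩ := hz
    refine ⟨t / signedGap (rotationNumber f) n, ⟨div_nonneg_of_nonpos ht.2 hs.le,
      (div_le_one_of_neg hs).2 ht.1.le⟩, ?_⟩
    rw [div_mul_cancel₀ _ hs.ne]
    exact htz.symm
  · rw [C.dynInterval_of_pos hirr h01 hs] at hz
    obtain ⟨t, ht, htz⟩ := hz
    refine ⟨t / signedGap (rotationNumber f) n, ⟨div_nonneg ht.1.le hs.le,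
      (div_le_one hs).2 ht.2⟩, ?_⟩
    rw [div_mul_cancel₀ _ hs.ne']
    exact htz.symm

theorem mem_dynInterval {n : ℕ} {z : S1} {θ : ℝ} (hθ : θ ∈ Ioo (0 : ℝ) 1)
    (hz : h z = ((θ * signedGap (rotationNumber f) n : ℝ) : S1)) : z ∈ dynInterval f x n := by
  rcases lt_or_gt_of_ne (signedGap_ne_zero hirr h01 n) with hs | hs
  · rw [C.dynInterval_of_neg hirr h01 hs]
    exact ⟨_, ⟨by nlinarith [hθ.2], (mul_neg_of_pos_of_neg hθ.1 hs).le⟩, hz.symm⟩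
  · rw [C.dynInterval_of_pos hirr h01 hs]
    exact ⟨_, ⟨mul_pos hθ.1 hs, (mul_lt_of_lt_one_left hs hθ.2).le⟩, hz.symm⟩

theorem measureReal_ratio {n : ℕ} {z : S1} {θ : ℝ} (hθ : θ ∈ Ioo (0 : ℝ) 1)
    (hz : h z = ((θ * signedGap (rotationNumber f) n : ℝ) : S1)) :
    μ.real (openArcIn (dynInterval f x n) x z) / μ.real (dynInterval f x n) = θ := by
  have hgap := gap_lt_one hirr h01 n
  rw [← abs_signedGap hirr h01] at hgap
  have hbase : h x = ((0 : ℝ) : S1) := C.base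
  rcases lt_or_gt_of_ne (signedGap_ne_zero hirr h01 n) with hs | hs
  · rw [C.dynInterval_of_neg hirr h01 hs]
    set s := signedGap (rotationNumber f) n with hsdef
    rw [abs_of_neg hs] at hgap
    have h1 : θ * s < 0 := mul_neg_of_pos_of_neg hθ.1 hs
    have h2 : s < θ * s := by nlinarith [hθ.2]
    have hz' : h z = ((θ * s + 1 : ℝ) : S1) :=
      hz.trans (coe_eq_coe_iff.2 ⟨-1, by push_cast; ring⟩)
    have hnot : ¬ Set.cIoo x z ⊆ h ⁻¹' ((fun t : ℝ => (t : S1)) '' Ioc s 0) := by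
      rw [C.cIoo_eq, hbase, hz', cIoo_coe (by linarith) (by linarith),
        h.surjective.preimage_subset_preimage_iff]
      intro hsub
      -- The midpoint of the arc complementary to Iₙ lies on the arc from x counterclockwise to z.
      obtain ⟨t, ht, hts⟩ := hsub ⟨(s + 1) / 2, ⟨by linarith, by linarith⟩, rfl⟩
      have : t + 1 = (s + 1) / 2 := coe_injOn_Ioc 0 ⟨by linarith [ht.1], by linarith [ht.2]⟩
        ⟨by linarith, by linarith⟩ ((coe_eq_coe_iff.2 ⟨1, by simp⟩).trans hts)
      linarith [ht.1]
    rw [openArcIn, if_neg hnot, C.cIoo_eq, hbase, hz, cIoo_coe h1.le (by linarith),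
      C.measureReal, C.measureReal, Measure.real, Measure.real, volume_image_Ioo (by linarith),
      volume_image_Ioc hs (by linarith), ENNReal.toReal_ofReal (by linarith),
      ENNReal.toReal_ofReal (by linarith)]
    field_simp
    ring
  · rw [C.dynInterval_of_pos hirr h01 hs]
    set s := signedGap (rotationNumber f) n with hsdef
    rw [abs_of_pos hs] at hgap
    have h1 : 0 < θ * s := mul_pos hθ.1 hs
    have h2 : θ * s < s := mul_lt_of_lt_one_left hs hθ.2
    have harc : Set.cIoo x z = h ⁻¹' ((fun t : ℝ => (t : S1)) '' Ioo 0 (θ * s)) := by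
      rw [C.cIoo_eq, hbase, hz, cIoo_coe h1.le (by linarith)]
    have hsub : Set.cIoo x z ⊆ h ⁻¹' ((fun t : ℝ => (t : S1)) '' Ioc 0 s) := by
      rw [harc]
      exact preimage_mono (image_mono fun t ht => ⟨ht.1, (ht.2.trans h2).le⟩)
    rw [openArcIn, if_pos hsub, harc, C.measureReal, C.measureReal, Measure.real, Measure.real,
      volume_image_Ioo (by linarith), volume_image_Ioc hs (by linarith),
      ENNReal.toReal_ofReal (by linarith), ENNReal.toReal_ofReal (by linarith)]
    field_simp
    ring

omit hirr h01 in
theorem exists_iterate_eq {i : ℕ} {y : S1} {t : ℝ}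
    (hy : ((i * rotationNumber f + t : ℝ) : S1) = h y) : ∃ z, h z = (t : S1) ∧ f^[i] z = y := by
  obtain ⟨z, hz⟩ := h.surjective (t : S1)
  refine ⟨z, hz, h.injective ?_⟩
  rw [C.conj_iterate, hz, ← hy, ← AddCircle.coe_add, add_comm]

omit hirr h01 in
theorem eq_of_iterate_eq {i : ℕ} {y z : S1} {t : ℝ} (hz : h z = (t : S1)) (hy : f^[i] z = y) :
    ((i * rotationNumber f + t : ℝ) : S1) = h y := by
  rw [← hy, C.conj_iterate, hz, ← AddCircle.coe_add, add_comm]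

theorem trailAlpha_mem_of_long {n : ℕ} {y : S1} {e g : ℝ} (he : 0 ≤ e) (hg : g ≤ 1)
    (hy : h y ∈ tower (rotationNumber f) (returnTime (rotationNumber f) (n + 1))
      (signedGap (rotationNumber f) n) e g) : trailAlpha f μ x y (n + 1) ∈ Ioo e g := by
  obtain ⟨i, hi, θ, hθ, hiy⟩ := mem_tower.1 hy
  have hθ' : θ ∈ Ioo (0 : ℝ) 1 := ⟨he.trans_lt hθ.1, hθ.2.trans_le hg⟩
  obtain ⟨z, hz, hzy⟩ := C.exists_iterate_eq hiy
  have hex : ∃ z, IsLongAncestor f x y n z :=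
    ⟨z, C.mem_dynInterval hirr h01 hθ' hz, i, hi, hzy⟩
  have hanc : h (ancestor f x y n) = ((θ * signedGap (rotationNumber f) n : ℝ) : S1) := by
    rw [ancestor, dif_pos hex]
    -- The ancestor is an arbitrary choice; uniqueness of tower positions gives it the coordinate θ.
    obtain ⟨hw, j, hj, hjy⟩ := hex.choose_spec
    obtain ⟨θ', hθ₁, hw'⟩ := C.exists_of_mem_dynInterval hirr h01 hw
    rw [(tower_position_unique hirr h01 hi hj (signedGap_ne_zero hirr h01 n)
      (abs_signedGap hirr h01 n).le hθ' hθ₁ (hiy.trans (C.eq_of_iterate_eq hw' hjy).symm)).2]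
    exact hw'
  rw [trailAlpha, if_pos hex, C.measureReal_ratio hirr h01 hθ' hanc]
  exact hθ

theorem trailAlpha_mem_of_short {n : ℕ} {y : S1} {e g : ℝ} (he : 0 ≤ e) (hg : g ≤ 1)
    (hy : h y ∈ tower (rotationNumber f) (returnTime (rotationNumber f) n)
      (signedGap (rotationNumber f) (n + 1)) e g) :
    trailAlpha f μ x y (n + 1) ∈ Ioo (-g) (-e) := by
  obtain ⟨j, hj, θ, hθ, hjy⟩ := mem_tower.1 hy
  have hθ' : θ ∈ Ioo (0 : ℝ) 1 := ⟨he.trans_lt hθ.1, hθ.2.trans_le hg⟩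
  have hle := returnTime_le_succ hirr h01 n
  obtain ⟨z, hz, hzy⟩ := C.exists_iterate_eq hjy
  have hnot : ¬ ∃ z, IsLongAncestor f x y n z := by
    rintro ⟨w, hw, i, hi, hiy⟩
    obtain ⟨θ₁, hθ₁, hw'⟩ := C.exists_of_mem_dynInterval hirr h01 hw
    have h1 := gap_pos hirr h01 n
    have h2 := gap_pos hirr h01 (n + 1)
    exact tower_position_disjoint hirr h01 hi hj
      (add_pos_of_nonneg_of_pos (mul_nonneg hθ₁.1 h1.le) (mul_pos hθ'.1 h2))
      (add_lt_add_of_le_of_lt (mul_le_of_le_one_left h1.le hθ₁.2)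
        (mul_lt_of_lt_one_left h2 hθ'.2)) ((C.eq_of_iterate_eq hw' hiy).trans hjy.symm)
  have hex : ∃ z, IsShortAncestor f x y n z :=
    ⟨z, C.mem_dynInterval hirr h01 hθ' hz, j, hj, hzy⟩
  have hanc : h (ancestor f x y n) = ((θ * signedGap (rotationNumber f) (n + 1) : ℝ) : S1) := by
    rw [ancestor, dif_neg hnot, dif_pos hex]
    obtain ⟨hw, k, hk, hky⟩ := hex.choose_spec
    obtain ⟨θ', hθ₁, hw'⟩ := C.exists_of_mem_dynInterval hirr h01 hw
    rw [(tower_position_unique hirr h01 (hj.trans_le hle) (hk.trans_le hle)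
      (signedGap_ne_zero hirr h01 (n + 1))
      ((abs_signedGap hirr h01 (n + 1)).le.trans (gap_succ_lt hirr h01 n).le) hθ' hθ₁
      (hjy.trans (C.eq_of_iterate_eq hw' hky).symm)).2]
    exact hw'
  rw [trailAlpha, if_neg hnot, C.measureReal_ratio hirr h01 hθ' hanc]
  exact ⟨neg_lt_neg hθ.2, neg_lt_neg hθ.1⟩

omit hirr h01 in
theorem isProbabilityMeasure : IsProbabilityMeasure μ :=
  ⟨by rw [← preimage_univ (f := h), C.measure, UnitAddCircle.measure_univ]⟩

theorem trail_mem {y : S1} (hy : ∀ n, h y ∈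
      tower (rotationNumber f) (returnTime (rotationNumber f) (n + 1))
        (signedGap (rotationNumber f) n) 0 1 ∪
      tower (rotationNumber f) (returnTime (rotationNumber f) n)
        (signedGap (rotationNumber f) (n + 1)) 0 1) (n : ℕ) :
    trail f μ x y n ∈ Icc (0 : ℝ) 1 ×ˢ Icc (-1 : ℝ) 1 := by
  refine ⟨Ioo_subset_Icc_self (gauss_iterate_mem_Ioo hirr h01 n), ?_⟩
  change trailAlpha f μ x y n ∈ Icc (-1 : ℝ) 1
  cases n with
  | zero =>
    have := C.isProbabilityMeasure
    rw [trailAlpha]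
    split_ifs
    · exact ⟨by linarith [measureReal_nonneg (μ := μ) (s := openArcIn (dynInterval f x 1) x y)],
        measureReal_le_one⟩
    · exact ⟨by linarith [measureReal_le_one (μ := μ) (s := Set.cIoo x y)],
        by linarith [measureReal_nonneg (μ := μ) (s := Set.cIoo x y)]⟩
  | succ n =>
    rcases hy n with hl | hs
    · have := C.trailAlpha_mem_of_long hirr h01 le_rfl le_rfl hl
      exact ⟨by linarith [this.1], this.2.le⟩
    · have := C.trailAlpha_mem_of_short hirr h01 le_rfl le_rfl hs
      exact ⟨this.1.le, by linarith [this.2]⟩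

theorem subset_closure_range_trail {y : S1}
    (hlong : ∀ c d e g : ℚ, 0 < c → c < d → d < 1 → 0 < e → e < g → g < 1 →
      ∃ n, gauss^[n + 1] (rotationNumber f) ∈ Ioo (c : ℝ) d ∧
        h y ∈ tower (rotationNumber f) (returnTime (rotationNumber f) (n + 1))
          (signedGap (rotationNumber f) n) e g)
    (hshort : ∀ c d e g : ℚ, 0 < c → c < d → d < 1 → 0 < e → e < g → g < 1 →
      ∃ n, gauss^[n + 1] (rotationNumber f) ∈ Ioo (c : ℝ) d ∧
        h y ∈ tower (rotationNumber f) (returnTime (rotationNumber f) n)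
          (signedGap (rotationNumber f) (n + 1)) e g) :
    Icc (0 : ℝ) 1 ×ˢ Icc (-1 : ℝ) 1 ⊆ closure (range (trail f μ x y)) := by
  have hrat : ∀ a ∈ Ioo (0 : ℝ) 1, ∀ ε > 0, ∃ c d : ℚ, 0 < c ∧ c < d ∧ d < 1 ∧
      ∀ t ∈ Ioo (c : ℝ) d, |t - a| < ε := by
    intro a ha ε hε
    obtain ⟨c, hc₁, hc₂⟩ := exists_rat_btwn (max_lt ha.1 (sub_lt_self a hε))
    obtain ⟨d, hd₁, hd₂⟩ := exists_rat_btwn (lt_min ha.2 (lt_add_of_pos_right a hε))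
    rw [max_lt_iff] at hc₁
    rw [lt_min_iff] at hd₂
    refine ⟨c, d, by exact_mod_cast hc₁.1, by exact_mod_cast hc₂.trans hd₁,
      by exact_mod_cast hd₂.1, fun t ht => ?_⟩
    rw [abs_lt]
    exact ⟨by linarith [ht.1], by linarith [ht.2]⟩
  -- Short towers serve α < 0 and long towers α > 0; the line α = 0 and the boundary are recovered
  -- by closure.
  have hsub : Ioo (0 : ℝ) 1 ×ˢ (Ioo (-1 : ℝ) 0 ∪ Ioo 0 1) ⊆ closure (range (trail f μ x y)) := by
    rintro ⟨r, a⟩ ⟨hr, ha⟩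
    refine Metric.mem_closure_range_iff.2 fun ε hε => ?_
    obtain ⟨c, d, hc, hcd, hd, hcdr⟩ := hrat r hr ε hε
    rcases ha with ha | ha
    · obtain ⟨e, g, he, heg, hg, hega⟩ :=
        hrat (-a) ⟨by linarith [ha.2], by linarith [ha.1]⟩ ε hε
      obtain ⟨n, hn, hy⟩ := hshort c d e g hc hcd hd he heg hg
      have hmem := C.trailAlpha_mem_of_short hirr h01 (by exact_mod_cast he.le)
        (by exact_mod_cast hg.le) hy
      refine ⟨n + 1, ?_⟩
      rw [dist_comm, Prod.dist_eq]
      refine max_lt (hcdr _ hn) ?_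
      have := hega (-trailAlpha f μ x y (n + 1)) ⟨by linarith [hmem.2], by linarith [hmem.1]⟩
      rw [neg_sub_neg, abs_sub_comm] at this
      exact this
    · obtain ⟨e, g, he, heg, hg, hega⟩ := hrat a ha ε hε
      obtain ⟨n, hn, hy⟩ := hlong c d e g hc hcd hd he heg hg
      refine ⟨n + 1, ?_⟩
      rw [dist_comm, Prod.dist_eq]
      exact max_lt (hcdr _ hn) (hega _ (C.trailAlpha_mem_of_long hirr h01
        (by exact_mod_cast he.le) (by exact_mod_cast hg.le) hy))
  have hcl := closure_minimal hsub isClosed_closure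
  rw [closure_prod_eq, closure_union, closure_Ioo (by norm_num), closure_Ioo (by norm_num),
    Icc_union_Icc_eq_Icc (by norm_num) (by norm_num)] at hcl
  exact hcl

end IsRotationChart

/-! ### Generic points in the sense of category and of measure -/

theorem dense_of_volume_compl_eq_zero {G : Set S1} (hG : volume Gᶜ = 0) : Dense G :=
  Measure.dense_of_ae (mem_ae_iff.2 hG)

namespace IsRotationChart

variable {f : S1 ≃ₜ S1} {μ : Measure S1} {x : S1} {h : S1 ≃ₜ S1} (C : IsRotationChart f μ x h)
include C

/-- The trail of a point is dense generically for every notion of genericity under which open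
sets of full Lebesgue measure are generic. -/
theorem eventually_closure_range_trail (hρ : rotationNumber f ∈ gaussGeneric) (l : Filter S1)
    [CountableInterFilter l]
    (hl : ∀ G : Set S1, IsOpen G → volume Gᶜ = 0 → ∀ᶠ y in l, h y ∈ G) :
    ∀ᶠ y in l, closure (range (trail f μ x y)) = Icc (0 : ℝ) 1 ×ˢ Icc (-1 : ℝ) 1 := by
  obtain ⟨hirr, h01, -⟩ := id hρ
  have hs := signedGap_ne_zero hirr h01
  have hcov := eventually_countable_forall.2 fun n => hl _
    ((isOpen_tower _ (returnTime _ (n + 1)) (hs n)).union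
      (isOpen_tower _ (returnTime _ n) (hs (n + 1)))) (volume_compl_towers hirr h01 n)
  have hopen : ∀ (p : ℕ → Prop) (q : ℕ → ℕ) (s : ℕ → ℝ) (e g : ℝ), (∀ n, s n ≠ 0) →
      IsOpen {y : S1 | ∃ n, p n ∧ y ∈ tower (rotationNumber f) (q n) (s n) e g} := by
    intro p q s e g hs
    simp only [ofPred_exists, ofPred_and]
    exact isOpen_iUnion fun n => isOpen_const.inter (isOpen_tower _ _ (hs n))
  have hlong : ∀ᶠ y in l, ∀ c d e g : ℚ, 0 < c → c < d → d < 1 → 0 < e → e < g → g < 1 →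
      ∃ n, gauss^[n + 1] (rotationNumber f) ∈ Ioo (c : ℝ) d ∧
        h y ∈ tower (rotationNumber f) (returnTime (rotationNumber f) (n + 1))
          (signedGap (rotationNumber f) n) e g := by
    simp only [eventually_countable_forall]
    intro c d e g hc hcd hd he heg hg
    exact hl _ (hopen _ _ _ _ _ hs) (volume_compl_exists_mem_longTower hρ (by exact_mod_cast hc)
      (by exact_mod_cast hcd) (by exact_mod_cast hd.le) (by exact_mod_cast he.le)
      (by exact_mod_cast heg) (by exact_mod_cast hg.le))
  have hshort : ∀ᶠ y in l, ∀ c d e g : ℚ, 0 < c → c < d → d < 1 → 0 < e → e < g → g < 1 →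
      ∃ n, gauss^[n + 1] (rotationNumber f) ∈ Ioo (c : ℝ) d ∧
        h y ∈ tower (rotationNumber f) (returnTime (rotationNumber f) n)
          (signedGap (rotationNumber f) (n + 1)) e g := by
    simp only [eventually_countable_forall]
    intro c d e g hc hcd hd he heg hg
    exact hl _ (hopen _ _ _ _ _ fun n => hs (n + 1)) (volume_compl_exists_mem_shortTower hρ
      (by exact_mod_cast hc) (by exact_mod_cast hcd) (by exact_mod_cast hd.le)
      (by exact_mod_cast he.le) (by exact_mod_cast heg) (by exact_mod_cast hg.le))
  filter_upwards [hcov, hlong, hshort] with y h1 h2 h3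
  refine Subset.antisymm (closure_minimal ?_ (isClosed_Icc.prod isClosed_Icc))
    (C.subset_closure_range_trail hirr h01 h2 h3)
  rintro _ ⟨n, rfl⟩
  exact C.trail_mem hirr h01 h1 n

omit C in
theorem eventually_residual {G : Set S1} (ho : IsOpen G) (hG : volume Gᶜ = 0) :
    ∀ᶠ y in residual S1, h y ∈ G :=
  residual_of_dense_open (ho.preimage h.continuous)
    ((dense_of_volume_compl_eq_zero hG).preimage h.isOpenMap)

theorem eventually_ae {G : Set S1} (hG : volume Gᶜ = 0) : ∀ᵐ y ∂μ, h y ∈ G := by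
  rw [ae_iff, ← hG, ← C.measure]
  rfl

end IsRotationChart

/-! ### The invariant measure and the charts based at each point -/

/-- The measure obtained from Lebesgue measure by a conjugacy with a rotation is an
invariant probability measure. -/
theorem isInvariantProbability_map_symm {f h : S1 ≃ₜ S1} {ρ : ℝ}
    (hconj : ∀ y, h (f y) = h y + (ρ : S1)) :
    IsInvariantProbability f (volume.map h.symm) := by
  have hprob : IsProbabilityMeasure (volume : Measure S1) := ⟨UnitAddCircle.measure_univ⟩
  refine ⟨Measure.isProbabilityMeasure_map h.symm.continuous.measurable.aemeasurable, ?_⟩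
  have hcomp : (f ∘ h.symm : S1 → S1) = h.symm ∘ fun y => y + (ρ : S1) := by
    funext y
    refine h.injective ?_
    simp [hconj]
  rw [Measure.map_map f.continuous.measurable h.symm.continuous.measurable, hcomp,
    ← Measure.map_map h.symm.continuous.measurable (measurable_add_const _),
    map_add_right_eq_self]

theorem eq_map_symm_of_isInvariantProbability {f h : S1 ≃ₜ S1} {ρ : ℝ} (hρ : Irrational ρ)
    (hconj : ∀ y, h (f y) = h y + (ρ : S1)) {ν : Measure S1} (hν : IsInvariantProbability f ν) :
    ν = volume.map h.symm := by
  have := hν.1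
  have : IsProbabilityMeasure (ν.map h) :=
    Measure.isProbabilityMeasure_map h.continuous.measurable.aemeasurable
  have hcomp : (fun y => y + (ρ : S1)) ∘ h = h ∘ f := by
    funext y
    exact (hconj y).symm
  have hmap : ν.map h = volume := by
    refine eq_volume_of_rotation_invariant hρ _ ?_
    rw [Measure.map_map (measurable_add_const _) h.continuous.measurable, hcomp,
      ← Measure.map_map h.continuous.measurable f.continuous.measurable, hν.2]
  rw [← hmap, Measure.map_map h.symm.continuous.measurable h.continuous.measurable]
  simp

/-- Following h by a translation moves x to the origin without changing Lebesgue measure, so a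
single invariant measure serves every base point. -/
theorem isRotationChart {f h : S1 ≃ₜ S1}
    (hconj : ∀ y, h (f y) = h y + (rotationNumber f : S1))
    (harc : ∀ a b c, c ∈ Set.cIoo a b ↔ h c ∈ Set.cIoo (h a) (h b)) (x : S1) :
    IsRotationChart f (volume.map h.symm) x (h.trans (Homeomorph.addRight (-h x))) where
  conj y := by simp [hconj]; abel
  base := by simp
  mem_cIoo a b c := (harc a b c).trans (mem_cIoo_add_const _ _ _ _)
  measure S := by
    rw [← h.symm.toMeasurableEquiv_coe, MeasurableEquiv.map_apply]
    simp only [Homeomorph.toMeasurableEquiv_coe, ← preimage_comp]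
    have : (h.trans (Homeomorph.addRight (-h x))) ∘ h.symm = fun y : S1 => y + -h x := by
      funext y
      simp
    rw [this, measure_preimage_add_right]

end CircleTrail

theorem mainTheorem7 :
    ∃ R : Set ℝ, R ⊆ Set.Icc 0 1 ∧ (∀ ρ ∈ R, Irrational ρ) ∧
      MeasureTheory.volume (Set.Icc (0 : ℝ) 1 \ R) = 0 ∧
      ∀ f : CircleTrail.S1 ≃ₜ CircleTrail.S1,
        CircleTrail.OrientationPreserving f → CircleTrail.MinimalHomeo f →
        CircleTrail.rotationNumber f ∈ R →
        ∃ μ : MeasureTheory.Measure CircleTrail.S1,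
          CircleTrail.IsInvariantProbability f μ ∧
          (∀ ν : MeasureTheory.Measure CircleTrail.S1,
            CircleTrail.IsInvariantProbability f ν → ν = μ) ∧
          ∀ x : CircleTrail.S1, ∃ B : Set CircleTrail.S1,
            B ∈ residual CircleTrail.S1 ∧ μ Bᶜ = 0 ∧
            ∀ y ∈ B, closure (Set.range (CircleTrail.trail f μ x y)) =
              Set.Icc (0 : ℝ) 1 ×ˢ Set.Icc (-1 : ℝ) 1 := by
  refine ⟨CircleTrail.gaussGeneric, fun ρ hρ => Ioo_subset_Icc_self hρ.2.1, fun ρ hρ => hρ.1,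
    CircleTrail.volume_diff_gaussGeneric, fun f ho hf hρ => ?_⟩
  obtain ⟨h, hconj, harc⟩ := CircleTrail.exists_conj_rotation ho hf hρ.1
  refine ⟨volume.map h.symm, CircleTrail.isInvariantProbability_map_symm hconj,
    fun ν hν => CircleTrail.eq_map_symm_of_isInvariantProbability hρ.1 hconj hν, fun x => ?_⟩
  have C := CircleTrail.isRotationChart hconj harc x
  -- The set B consists of all y whose trail has the required closure; one argument, run with the
  -- residual filter and with the almost-everywhere filter, shows it large in both senses.
  exact ⟨_, C.eventually_closure_range_trail hρ (residual _) fun G ho hG => CircleTrail.IsRotationChart.eventually_residual ho hG,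
    mem_ae_iff.1 (C.eventually_closure_range_trail hρ (ae _) fun G _ hG => C.eventually_ae hG),
    fun y hy => hy⟩
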